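/- In the problem \textsc{SquareInSquareArea}, a non-empty finite stream $L$ of axis-parallel squares of positive side length arrives one by one. Each square must be placed in the plane, by translation only and with interior disjoint from the squares placed before, without knowledge of later ones. The cost of a packing is the area of the smallest axis-parallel square containing all pieces, and $\mathrm{Opt}(L)$ is the minimum cost of a packing of $L$ when the whole stream is known. \textbf{Bricks.} For $k\in\mathbb Z$, a $k$-brick is a rectangle of size (width $\times$ height) $\sqrt2^{\,-k}\times\sqrt2^{\,-k-1}$ if $k$ is even and $\sqrt2^{\,-k-1}\times\sqrt2^{\,-k}$ if $k$ is odd. The fundamental brick $B_k$ is the $k$-brick with lower left corner $(0,\sqrt2^{\,-k-1})$ if $k$ is even and $(\sqrt2^{\,-k-1},0)$ if $k$ is odd. A $k$-brick $B$ is split into two $(k+1)$-bricks: $B\dagger1$ is the left half of $B$ if $k$ is even and the lower half if $k$ is odd, and $B\dagger2$ is the other half. The derived bricks are the bricks $B_i\dagger b_1\dagger\cdots\dagger b_\ell$ with $i\in\mathbb Z$, $\ell\ge0$ and $b_1,\dots,b_\ell\in\{1,2\}$. Derived $k$-bricks are ordered by $\prec$: if $D_1\subset B_i$ and $D_2\subset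 B_j$ with $i>j$, then $D_1\prec D_2$; if $i=j$, the sequences $(b_1,\dots,b_\ell)$ are compared lexicographically. A $k$-brick is suitable for a piece $p$ if $p$ fits in a $k$-brick (without rotation) but not in a $(k+1)$-brick. \textbf{The algorithm \textsc{BrickTranslation}.} It maintains a collection $\mathcal D$ of interior-disjoint derived bricks, initially empty. In a $k$-brick of $\mathcal D$, the first piece is placed at the lower left corner; each later piece is placed on top of the previous one along the left edge if $k$ is even, and to the right of the previous one along the bottom edge if $k$ is odd. The brick has room for a piece if this rule places the piece within the brick. When a piece $p$ arrives, let $k$ be such that a $k$-brick is suitable for $p$. If some $k$-brick in $\mathcal D$ has room for $p$, then $p$ is packed there. Otherwise let $D$ be the $\prec$-minimum derived $k$-brick that is interior-disjoint from every brick of $\mathcal D$; add $D$ to $\mathcal D$ and pack $p$ in $D$. Let $\mathrm{Alg}(L)$ be the cost of the resulting placement of $L$. \textbf{Theorem.} For every non-empty finite stream $L$ of squares, \textsc{BrickTranslation} produces a packing of $L$ (the placed squares have pairwise disjoint interiors). It has absolute competitive ratio $6$ for \textsc{SquareInSquareArea}: \[ \sup_{L}\frac{\mathrm{Alg}(L)}{6\,\mathrm{Opt}(L)}\le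 1 . \] This is tight, also asymptotically: there are streams $L_0,L_1,L_2,\dots$ of squares with $\mathrm{Alg}(L_n)/\mathrm{Opt}(L_n)\to6$ and $\mathrm{Opt}(L_n)\to\infty$ as $n\to\infty$. -/

import Mathlib

open Set Filter Topology

noncomputable section

namespace OnlinePacking

/-! ### Pieces, packings and their cost -/

/-- A piece: an axis-parallel rectangle of positive width and height, given up to translation. -/
structure Piece where
  width : ℝ
  height : ℝ
  width_pos : 0 < width
  height_pos : 0 < height

/-- The closed axis-parallel rectangle of size `w × h` with lower left corner `c`. -/
def rect (c : ℝ × ℝ) (w h : ℝ) : Set (ℝ × ℝ) :=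
  Icc c.1 (c.1 + w) ×ˢ Icc c.2 (c.2 + h)

/-- Two regions are interior-disjoint. -/
def InteriorDisjoint (A B : Set (ℝ × ℝ)) : Prop :=
  Disjoint (interior A) (interior B)

/-- A piece together with the position of its lower left corner. -/
structure PlacedPiece where
  piece : Piece
  corner : ℝ × ℝ

/-- The region occupied by a placed piece. -/
def PlacedPiece.region (q : PlacedPiece) : Set (ℝ × ℝ) :=
  rect q.corner q.piece.width q.piece.height

/-- `P` is a packing (by translations, without overlaps) of the stream `L`. -/
def IsPackingOf (P : List PlacedPiece) (L : List Piece) : Prop :=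
  P.map PlacedPiece.piece = L ∧
    P.Pairwise fun q r => InteriorDisjoint q.region r.region

/-- The area of the smallest axis-parallel square containing all the placed pieces. -/
def boundingSquareArea (P : List PlacedPiece) : ℝ :=
  sInf {A : ℝ | ∃ a : ℝ, 0 ≤ a ∧ A = a ^ 2 ∧
    ∃ c : ℝ × ℝ, ∀ q ∈ P, q.region ⊆ rect c a a}

/-! ### Bricks -/

/-- The width of a `k`-brick. -/
def brickWidth (k : ℤ) : ℝ :=
  if Even k then (Real.sqrt 2) ^ (-k) else (Real.sqrt 2) ^ (-k - 1)

/-- The height of a `k`-brick. -/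
def brickHeight (k : ℤ) : ℝ :=
  if Even k then (Real.sqrt 2) ^ (-k - 1) else (Real.sqrt 2) ^ (-k)

/-- A brick at a position in the plane: a `level`-brick with lower left corner `corner`. -/
structure Brick where
  level : ℤ
  corner : ℝ × ℝ

/-- The closed rectangle covered by a brick. -/
def Brick.region (B : Brick) : Set (ℝ × ℝ) :=
  rect B.corner (brickWidth B.level) (brickHeight B.level)

/-- The fundamental brick `B_k`; together the fundamental bricks tile the positive quadrant. -/
def fundamentalBrick (k : ℤ) : Brick where
  level := k
  corner := if Even k then (0, (Real.sqrt 2) ^ (-k - 1)) else ((Real.sqrt 2) ^ (-k - 1), 0)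

/-- The two halves of a `k`-brick, which are `(k+1)`-bricks: `B†1` (`b = false`) is the left half
if `k` is even and the lower half if `k` is odd, and `B†2` (`b = true`) is the other half. -/
def Brick.half (B : Brick) (b : Bool) : Brick where
  level := B.level + 1
  corner :=
    if b then
      if Even B.level then (B.corner.1 + brickWidth B.level / 2, B.corner.2)
      else (B.corner.1, B.corner.2 + brickHeight B.level / 2)
    else B.corner

/-- The derived brick `B_root † b₁ † ⋯ † b_ℓ`, where `path = [b₁, …, b_ℓ]`
(with `false` for `1` and `true` for `2`). -/
structure DerivedBrick where
  root : ℤ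
  path : List Bool

/-- The brick in the plane denoted by a derived brick. -/
def DerivedBrick.toBrick (D : DerivedBrick) : Brick :=
  D.path.foldl Brick.half (fundamentalBrick D.root)

/-- The `k` for which the derived brick is a `k`-brick. -/
def DerivedBrick.level (D : DerivedBrick) : ℤ := D.toBrick.level

/-- The region covered by a derived brick. -/
def DerivedBrick.region (D : DerivedBrick) : Set (ℝ × ℝ) := D.toBrick.region

/-- The order `≺` (used between derived bricks of equal level): bricks inside a fundamental brick
of larger index come first; inside the same fundamental brick, paths are compared
lexicographically. -/
def DerivedBrick.Prec (D E : DerivedBrick) : Prop :=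
  E.root < D.root ∨ (D.root = E.root ∧ D.path < E.path)

/-- A piece fits into an (empty) `k`-brick. -/
def FitsLevel (k : ℤ) (p : Piece) : Prop :=
  p.width ≤ brickWidth k ∧ p.height ≤ brickHeight k

/-- A `k`-brick is suitable for `p`: the piece fits in a `k`-brick but not in a `(k+1)`-brick. -/
def Suitable (k : ℤ) (p : Piece) : Prop :=
  FitsLevel k p ∧ ¬ FitsLevel (k + 1) p

/-- A derived brick is interior-disjoint from each brick of the collection `𝒟`. -/
def IsFree (𝒟 : List DerivedBrick) (D : DerivedBrick) : Prop :=
  ∀ E ∈ 𝒟, InteriorDisjoint D.region E.region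

/-- `D` is the `≺`-minimum among the derived `k`-bricks that are interior-disjoint from each
brick of `𝒟`. -/
def IsMinFree (k : ℤ) (𝒟 : List DerivedBrick) (D : DerivedBrick) : Prop :=
  (D.level = k ∧ IsFree 𝒟 D) ∧
    ∀ E : DerivedBrick, E.level = k → IsFree 𝒟 E → D = E ∨ D.Prec E

/-! ### Existence facts used by the definition of the algorithm -/

lemma one_lt_sqrt_two : (1 : ℝ) < Real.sqrt 2 := by
  rw [Real.lt_sqrt] <;> norm_num

lemma brickWidth_le (k : ℤ) : brickWidth k ≤ (Real.sqrt 2) ^ (-k) := by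
  unfold brickWidth
  split_ifs
  · exact le_rfl
  · exact zpow_le_zpow_right₀ one_lt_sqrt_two.le (by omega)

lemma le_brickWidth (k : ℤ) : (Real.sqrt 2) ^ (-k - 1) ≤ brickWidth k := by
  unfold brickWidth
  split_ifs
  · exact zpow_le_zpow_right₀ one_lt_sqrt_two.le (by omega)
  · exact le_rfl

lemma le_brickHeight (k : ℤ) : (Real.sqrt 2) ^ (-k - 1) ≤ brickHeight k := by
  unfold brickHeight
  split_ifs
  · exact le_rfl
  · exact zpow_le_zpow_right₀ one_lt_sqrt_two.le (by omega)

lemma brickWidth_pos (k : ℤ) : 0 < brickWidth k :=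
  lt_of_lt_of_le (zpow_pos (by linarith [one_lt_sqrt_two]) _) (le_brickWidth k)

lemma brickHeight_pos (k : ℤ) : 0 < brickHeight k :=
  lt_of_lt_of_le (zpow_pos (by linarith [one_lt_sqrt_two]) _) (le_brickHeight k)

/-- Every piece has a level that is suitable for it. -/
lemma exists_suitable (p : Piece) : ∃ k : ℤ, Suitable k p := by
  obtain ⟨n, hn⟩ := exists_pow_lt_of_lt_one p.width_pos
    (inv_lt_one_of_one_lt₀ one_lt_sqrt_two)
  obtain ⟨m, hm⟩ := pow_unbounded_of_one_lt (max p.width p.height) one_lt_sqrt_two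
  obtain ⟨k, hk, hmax⟩ := Int.exists_greatest_of_bdd (P := fun k => FitsLevel k p)
    ⟨n, fun z hz => by
      by_contra hlt
      push Not at hlt
      have h1 : (Real.sqrt 2) ^ (-z) ≤ (Real.sqrt 2) ^ (-(n : ℤ)) :=
        zpow_le_zpow_right₀ one_lt_sqrt_two.le (by omega)
      rw [zpow_neg _ (n : ℤ), zpow_natCast, ← inv_pow] at h1
      linarith [hz.1, brickWidth_le z]⟩
    ⟨-(m : ℤ) - 1, by
      have h2 : (Real.sqrt 2) ^ (-(-(m : ℤ) - 1) - 1) = (Real.sqrt 2) ^ m := by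
        rw [← zpow_natCast]; congr 1; ring
      have hw := le_brickWidth (-(m : ℤ) - 1)
      have hh := le_brickHeight (-(m : ℤ) - 1)
      rw [h2] at hw hh
      exact ⟨by linarith [le_max_left p.width p.height],
        by linarith [le_max_right p.width p.height]⟩⟩
  exact ⟨k, hk, fun h => by have := hmax _ h; omega⟩

lemma rect_subset {c d : ℝ × ℝ} {w h w' h' : ℝ} (h1 : d.1 ≤ c.1) (h2 : c.1 + w ≤ d.1 + w')
    (h3 : d.2 ≤ c.2) (h4 : c.2 + h ≤ d.2 + h') : rect c w h ⊆ rect d w' h' :=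
  prod_mono (Icc_subset_Icc h1 h2) (Icc_subset_Icc h3 h4)

lemma sqrt_two_zpow_half (k : ℤ) :
    (Real.sqrt 2) ^ (-(k + 1) - 1) = (Real.sqrt 2) ^ (-k) / 2 := by
  have h0 : Real.sqrt 2 ≠ 0 := by linarith [one_lt_sqrt_two]
  have : -(k + 1) - 1 = -k - 2 := by ring
  rw [this, zpow_sub₀ h0]
  congr 1
  exact_mod_cast Real.sq_sqrt (show (0 : ℝ) ≤ 2 by norm_num)

lemma brickWidth_succ (k : ℤ) :
    brickWidth (k + 1) = if Even k then brickWidth k / 2 else brickWidth k := by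
  have e : -(k + 1) = -k - 1 := by ring
  by_cases hk : Even k
  · have hk' : ¬ Even (k + 1) := by simpa [Int.even_add_one] using hk
    simp only [brickWidth, hk, hk', if_true, if_false, sqrt_two_zpow_half]
  · have hk' : Even (k + 1) := by simpa [Int.even_add_one] using hk
    simp only [brickWidth, hk, hk', if_true, if_false, e]

lemma brickHeight_succ (k : ℤ) :
    brickHeight (k + 1) = if Even k then brickHeight k else brickHeight k / 2 := by
  have e : -(k + 1) = -k - 1 := by ring
  by_cases hk : Even k
  · have hk' : ¬ Even (k + 1) := by simpa [Int.even_add_one] using hk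
    simp only [brickHeight, hk, hk', if_true, if_false, e]
  · have hk' : Even (k + 1) := by simpa [Int.even_add_one] using hk
    simp only [brickHeight, hk, hk', if_true, if_false, sqrt_two_zpow_half]

lemma Brick.half_region_subset (B : Brick) (b : Bool) : (B.half b).region ⊆ B.region := by
  have hw := brickWidth_pos B.level
  have hh := brickHeight_pos B.level
  unfold Brick.region Brick.half
  simp only [brickWidth_succ, brickHeight_succ]
  apply rect_subset <;> (split_ifs <;> linarith)

lemma foldl_half_region_subset (l : List Bool) (B : Brick) :
    (l.foldl Brick.half B).region ⊆ B.region := by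
  induction l generalizing B with
  | nil => exact subset_rfl
  | cons b l ih => exact (ih (B.half b)).trans (B.half_region_subset b)

lemma foldl_half_level (l : List Bool) (B : Brick) :
    (l.foldl Brick.half B).level = B.level + l.length := by
  induction l generalizing B with
  | nil => simp
  | cons b l ih =>
    rw [List.foldl_cons, ih]
    simp only [Brick.half, List.length_cons]
    push_cast
    ring

lemma DerivedBrick.level_eq (D : DerivedBrick) : D.level = D.root + D.path.length :=
  foldl_half_level _ _

lemma interiorDisjoint_rect_of_right {c d : ℝ × ℝ} {w h w' h' : ℝ} (hx : d.1 + w' ≤ c.1) :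
    InteriorDisjoint (rect c w h) (rect d w' h') := by
  unfold InteriorDisjoint rect
  rw [interior_prod_eq, interior_prod_eq, interior_Icc, interior_Icc, interior_Icc, interior_Icc,
    Set.disjoint_left]
  rintro x ⟨⟨h1, -⟩, -⟩ ⟨⟨-, h2⟩, -⟩
  linarith

lemma interiorDisjoint_rect_of_above {c d : ℝ × ℝ} {w h w' h' : ℝ} (hy : d.2 + h' ≤ c.2) :
    InteriorDisjoint (rect c w h) (rect d w' h') := by
  unfold InteriorDisjoint rect
  rw [interior_prod_eq, interior_prod_eq, interior_Icc, interior_Icc, interior_Icc, interior_Icc,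
    Set.disjoint_left]
  rintro x ⟨-, ⟨h1, -⟩⟩ ⟨-, ⟨-, h2⟩⟩
  linarith

lemma fundamental_interiorDisjoint {i j : ℤ} (hij : i < j) :
    InteriorDisjoint (fundamentalBrick i).region (fundamentalBrick j).region := by
  have key : ∀ m : ℤ, (Real.sqrt 2) ^ (-m - 1) + (Real.sqrt 2) ^ (-m - 1)
      = (Real.sqrt 2) ^ (-m + 1) := fun m => by
    have := sqrt_two_zpow_half (m - 1)
    rw [show -(m - 1 + 1) - 1 = -m - 1 by ring, show -(m - 1) = -m + 1 by ring] at this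
    linarith
  have mono : ∀ a b : ℤ, a ≤ b → (Real.sqrt 2) ^ a ≤ (Real.sqrt 2) ^ b := fun a b hab =>
    zpow_le_zpow_right₀ one_lt_sqrt_two.le hab
  unfold Brick.region
  by_cases hi : Even i
  · apply interiorDisjoint_rect_of_above
    by_cases hj : Even j
    · simp only [fundamentalBrick, brickHeight, hi, hj, if_true]
      rw [key]
      obtain ⟨a, rfl⟩ := hi
      obtain ⟨b, rfl⟩ := hj
      exact mono _ _ (by omega)
    · simp only [fundamentalBrick, brickHeight, hi, hj, if_true, if_false, zero_add]
      exact mono _ _ (by omega)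
  · apply interiorDisjoint_rect_of_right
    by_cases hj : Even j
    · simp only [fundamentalBrick, brickWidth, hi, hj, if_true, if_false, zero_add]
      exact mono _ _ (by omega)
    · simp only [fundamentalBrick, brickWidth, hi, hj, if_false]
      rw [key]
      rw [Int.not_even_iff_odd] at hi hj
      obtain ⟨a, rfl⟩ := hi
      obtain ⟨b, rfl⟩ := hj
      exact mono _ _ (by omega)

lemma exists_free (k : ℤ) (𝒟 : List DerivedBrick) :
    ∃ n : ℕ, ∃ l : List Bool, l.length = n ∧ IsFree 𝒟 ⟨k - n, l⟩ := by
  obtain ⟨n, hn⟩ : ∃ n : ℕ, ∀ E ∈ 𝒟, k - n < E.root := by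
    induction 𝒟 with
    | nil => exact ⟨0, by simp⟩
    | cons E 𝒟 ih =>
      obtain ⟨n, hn⟩ := ih
      refine ⟨n + (k - E.root).toNat + 1, ?_⟩
      intro F hF
      rcases List.mem_cons.1 hF with rfl | hF
      · push_cast; omega
      · have := hn F hF; push_cast; omega
  refine ⟨n, List.replicate n false, by simp, fun E hE => ?_⟩
  exact (fundamental_interiorDisjoint (hn E hE)).mono
    (interior_mono (foldl_half_region_subset _ _)) (interior_mono (foldl_half_region_subset _ _))

/-- The minimum required by the algorithm exists. -/
lemma exists_isMinFree (k : ℤ) (𝒟 : List DerivedBrick) : ∃ D, IsMinFree k 𝒟 D := by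
  classical
  have hex := exists_free k 𝒟
  let n := Nat.find hex
  obtain ⟨l₀, hl₀, hf₀⟩ := Nat.find_spec hex
  obtain ⟨l, ⟨hl, hf⟩, hmin⟩ := Set.exists_min_image
    {l : List Bool | l.length = n ∧ IsFree 𝒟 ⟨k - n, l⟩} id
    ((List.finite_length_eq Bool n).subset fun l hl => hl.1) ⟨l₀, hl₀, hf₀⟩
  refine ⟨⟨k - n, l⟩, ⟨?_, hf⟩, ?_⟩
  · rw [DerivedBrick.level_eq]; simp [hl]
  · rintro ⟨r, t⟩ hE hEf
    rw [DerivedBrick.level_eq] at hE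
    simp only at hE
    obtain rfl : r = k - t.length := by omega
    have hle : n ≤ t.length := Nat.find_min' hex ⟨t, rfl, hEf⟩
    rcases hle.lt_or_eq with hlt | heq
    · right; left; simp only; omega
    · have hlt : l ≤ t := hmin t ⟨heq.symm, by rw [heq]; exact hEf⟩
      rcases hlt.lt_or_eq with h | h
      · right; right; exact ⟨by simp only; omega, h⟩
      · left; subst h; rw [heq]

/-! ### The algorithm BrickTranslation -/

/-- The `k` such that a `k`-brick is suitable for `p`. -/
def suitableLevel (p : Piece) : ℤ := Classical.choose (exists_suitable p)

/-- The `≺`-minimum derived `k`-brick that is interior-disjoint from each brick of `𝒟`. -/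
def minFree (k : ℤ) (𝒟 : List DerivedBrick) : DerivedBrick :=
  Classical.choose (exists_isMinFree k 𝒟)

/-- A state of the algorithm: the pieces placed so far, in order of arrival, each with the derived
brick in which it has been packed. -/
abbrev State := List (PlacedPiece × DerivedBrick)

/-- The collection `𝒟` of bricks used so far. -/
def State.bricks (S : State) : List DerivedBrick := S.map Prod.snd

open Classical in
/-- The pieces that have been packed in the brick `D`. -/
def State.piecesIn (S : State) (D : DerivedBrick) : List Piece :=
  (S.filter fun q => q.2 = D).map fun q => q.1.piece

/-- The position at which the next piece would be put in `D`: on top of the stack of the pieces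
already packed in `D` if `D` is a `k`-brick with `k` even, to the right of them if `k` is odd, and
at the lower left corner of `D` if there are none. -/
def State.nextCorner (S : State) (D : DerivedBrick) : ℝ × ℝ :=
  if Even D.level then
    (D.toBrick.corner.1, D.toBrick.corner.2 + ((S.piecesIn D).map Piece.height).sum)
  else
    (D.toBrick.corner.1 + ((S.piecesIn D).map Piece.width).sum, D.toBrick.corner.2)

/-- The brick `D` has room for `p`: the stacking rule places `p` within `D`. -/
def State.HasRoom (S : State) (D : DerivedBrick) (p : Piece) : Prop :=
  PlacedPiece.region ⟨p, S.nextCorner D⟩ ⊆ D.region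

/-- Pack the piece `p` in the brick `D`. -/
def State.packIn (S : State) (p : Piece) (D : DerivedBrick) : State :=
  S ++ [(⟨p, S.nextCorner D⟩, D)]

open Classical in
/-- The brick in which the algorithm packs the next piece `p`: with `k` the suitable level,
a `k`-brick of `𝒟` that has room for `p` (the first one that was opened, if there are several),
and otherwise the `≺`-minimum derived `k`-brick interior-disjoint from all bricks of `𝒟`. -/
def State.chooseBrick (S : State) (p : Piece) : DerivedBrick :=
  match S.bricks.find? (fun D => D.level = suitableLevel p ∧ S.HasRoom D p) with
  | some D => D
  | none => minFree (suitableLevel p) S.bricks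

/-- One step of BrickTranslation. -/
def brickStep (S : State) (p : Piece) : State := S.packIn p (S.chooseBrick p)

/-- The packing produced by BrickTranslation on the stream `L`. -/
def brickTranslation (L : List Piece) : List PlacedPiece :=
  (L.foldl brickStep []).map Prod.fst

/-! ### The problem SquareInSquareArea and competitive ratios -/

/-- The non-empty (finite) streams of squares. -/
abbrev SquareStream := {L : List Piece // L ≠ [] ∧ ∀ p ∈ L, p.width = p.height}

/-- The cost of the packing produced by BrickTranslation: the area of its bounding square. -/
def algCost (L : SquareStream) : ℝ := boundingSquareArea (brickTranslation L.1)

/-- The cost of an optimal offline packing. -/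
def optCost (L : SquareStream) : ℝ :=
  sInf {c : ℝ | ∃ P : List PlacedPiece, IsPackingOf P L.1 ∧ c = boundingSquareArea P}

/-- An algorithm with cost `A` has absolute competitive ratio `f` on a class of streams with
optimal cost `Opt`: `sup_L A(L) / (Opt(L) f(L)) ≤ 1`, the supremum taken in `[0, ∞]`. -/
def HasAbsoluteCompetitiveRatio {Stream : Type} (A Opt f : Stream → ℝ) : Prop :=
  ⨆ L : Stream, ENNReal.ofReal (A L) / ENNReal.ofReal (Opt L * f L) ≤ 1

end OnlinePacking

end

noncomputable section

namespace OnlinePacking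

/-! ### Numbering the derived bricks of a fixed level -/

/-! The derived `k`-bricks, in the order `≺`, correspond to the positive integers: `B_i†b₁⋯b_ℓ`
receives the number with binary digits `1b₁⋯b_ℓ`. Reading index `n` at level `k` as the dyadic
interval `[n 2⁻ᵏ, (n+1) 2⁻ᵏ)` turns containment and overlap of bricks into those of intervals in
`(0, ∞)` (`DerivedBrick.interiorDisjoint_iff`), and the choice of the `≺`-minimum brick into
leftmost allocation.

Leftmost allocation leaves at most one maximal free interval of each length
(`UniqueMaximalFree.append`). So when index `n` is the first free one at level `k`, the free gaps to
its left are shorter than `2⁻ᵏ` in total, and the allocated intervals have length at least `(n-1)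
2⁻ᵏ` (`le_sum_length`). A square is too large to share its brick with another suitable one, and its
area is at least a quarter of the length of its interval. Hence the area of the stream bounds the
index of every brick in use.

It remains to bound the extent of a brick by its index. One coordinate of its corner is given by
every second digit of its path, and `evenDigits_bound` compares this number `Y` with the full binary
fraction `X`, essentially by `Y² ≤ 3X`. With `extent_inequality`, every square lies in a square at
the origin whose area is six times that of the stream, while `Opt` is at least the area of the
stream.

For tightness, take equal squares of side slightly above `1/2`, just enough to reach the upper left
corner of `B_{-2m}`. There are about `4^(m+1)/3` of them. A grid packs them at cost about `4^m/3`,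
while the algorithm extends over a height of about `√2 · 2^m`. -/

/-- The natural number with binary digits `l`, most significant digit first. -/
def binValue : List Bool → ℕ
  | [] => 0
  | b :: l => b.toNat * 2 ^ l.length + binValue l

lemma binValue_lt (l : List Bool) : binValue l < 2 ^ l.length := by
  induction l with
  | nil => simp [binValue]
  | cons b l ih =>
    have hb : b.toNat ≤ 1 := Bool.toNat_le b
    have := Nat.mul_le_mul_right (2 ^ l.length) hb
    simp only [binValue, List.length_cons, pow_succ]
    omega

lemma binValue_append (l r : List Bool) :
    binValue (l ++ r) = binValue l * 2 ^ r.length + binValue r := by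
  induction l with
  | nil => simp [binValue]
  | cons b l ih =>
    simp only [List.cons_append, binValue, ih, List.length_append, pow_add]
    ring

lemma binValue_injective {l r : List Bool} (hlen : l.length = r.length)
    (h : binValue l = binValue r) : l = r := by
  induction l generalizing r with
  | nil => exact (List.length_eq_zero_iff.1 hlen.symm).symm
  | cons b l ih =>
    cases r with
    | nil => simp at hlen
    | cons c r =>
      have hlen' : l.length = r.length := by simpa using hlen
      have h1 := binValue_lt l
      have h2 := binValue_lt r
      simp only [binValue, hlen'] at h h1
      have hbc : b = c := by
        cases b <;> cases c <;> simp at h ⊢ <;> omega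
      subst hbc
      rw [ih hlen' (by omega)]

lemma binValue_lt_of_lt {l r : List Bool} (hlen : l.length = r.length) (h : l < r) :
    binValue l < binValue r := by
  induction l generalizing r with
  | nil =>
    rw [List.length_eq_zero_iff.1 hlen.symm] at h
    exact absurd h (lt_irrefl _)
  | cons b l ih =>
    cases r with
    | nil => simp at hlen
    | cons c r =>
      have hlen' : l.length = r.length := by simpa using hlen
      have h1 := binValue_lt l
      simp only [binValue, hlen'] at h1 ⊢
      rcases List.cons_lt_cons_iff.1 h with hbc | ⟨rfl, hlt⟩
      · obtain ⟨rfl, rfl⟩ := Bool.lt_iff.1 hbc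
        simp only [Bool.toNat_false, Bool.toNat_true]
        omega
      · have := ih hlen' hlt
        omega

/-- The position of a derived brick in the `≺`-order of all derived bricks of its level; the
number with binary digits `1 b₁ ⋯ b_ℓ`. -/
def DerivedBrick.index (D : DerivedBrick) : ℕ := 2 ^ D.path.length + binValue D.path

lemma DerivedBrick.index_pos (D : DerivedBrick) : 0 < D.index := by
  unfold index; positivity

lemma DerivedBrick.index_lt (D : DerivedBrick) : D.index < 2 ^ (D.path.length + 1) := by
  have := binValue_lt D.path
  rw [index, pow_succ]; omega

/-- At equal level a larger root means a shorter path. The leading digit `1` makes longer paths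
larger as numbers, and paths of equal length compare as binary numbers. -/
lemma DerivedBrick.index_lt_of_prec {D E : DerivedBrick} (hl : D.level = E.level)
    (h : D.Prec E) : D.index < E.index := by
  rw [level_eq, level_eq] at hl
  rcases h with h | ⟨hr, h⟩
  · refine D.index_lt.trans_le ((Nat.pow_le_pow_right two_pos ?_).trans (Nat.le_add_right _ _))
    omega
  · have hlen : D.path.length = E.path.length := by omega
    have := binValue_lt_of_lt hlen h
    rw [index, index, hlen]; omega

lemma DerivedBrick.ext_of_level_index {D E : DerivedBrick} (hl : D.level = E.level)
    (hi : D.index = E.index) : D = E := by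
  have hlen : D.path.length = E.path.length := by
    have h1 := D.index_lt
    have h2 := E.index_lt
    have h3 : 2 ^ D.path.length ≤ D.index := Nat.le_add_right _ _
    have h4 : 2 ^ E.path.length ≤ E.index := Nat.le_add_right _ _
    have h5 := (Nat.pow_lt_pow_iff_right (a := 2) (by norm_num)).1 (h3.trans_lt (hi ▸ h2))
    have h6 := (Nat.pow_lt_pow_iff_right (a := 2) (by norm_num)).1 (h4.trans_lt (hi ▸ h1))
    omega
  rw [level_eq, level_eq] at hl
  have hp : D.path = E.path := binValue_injective hlen (by rw [index, index, hlen] at hi; omega)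
  have hr : D.root = E.root := by omega
  cases D; cases E; simp_all

/-- Dropping the last binary digit of `n` gives the index of the brick one level up, of which the
desired brick is a half. -/
lemma DerivedBrick.exists_level_index (k : ℤ) {n : ℕ} (hn : 0 < n) :
    ∃ D : DerivedBrick, D.level = k ∧ D.index = n := by
  induction n using Nat.strong_induction_on generalizing k with
  | _ n ih =>
    rcases Nat.lt_or_ge n 2 with h | h
    · exact ⟨⟨k, []⟩, by simp [level_eq], by simp [index, binValue]; omega⟩
    · obtain ⟨D, hD, hDi⟩ := ih (n / 2) (by omega) (k - 1) (by omega)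
      refine ⟨⟨D.root, D.path ++ [decide (n % 2 = 1)]⟩, ?_, ?_⟩
      · rw [level_eq] at hD ⊢
        simp only [List.length_append, List.length_singleton]
        push_cast; omega
      · rw [index] at hDi ⊢
        simp only [List.length_append, List.length_singleton, binValue_append, pow_succ, pow_zero,
          binValue, List.length_nil]
        rcases Nat.mod_two_eq_zero_or_one n with h | h <;> simp [h] <;> omega

/-- `(j, x)` and `(k, a)` denote nested dyadic intervals, where `(k, a)` stands for
`[a 2⁻ᵏ, (a + 1) 2⁻ᵏ)`. -/
def Nested (j : ℤ) (x : ℕ) (k : ℤ) (a : ℕ) : Prop :=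
  ∃ d : ℕ, (k = j + d ∧ a / 2 ^ d = x) ∨ (j = k + d ∧ x / 2 ^ d = a)

lemma Nested.symm {j k : ℤ} {x a : ℕ} (h : Nested j x k a) : Nested k a j x := by
  obtain ⟨d, h⟩ := h
  exact ⟨d, h.symm⟩

lemma DerivedBrick.index_div_of_append (i : ℤ) (p r : List Bool) :
    DerivedBrick.index ⟨i, p ++ r⟩ / 2 ^ r.length = DerivedBrick.index ⟨i, p⟩ := by
  have := binValue_lt r
  simp only [index, List.length_append, binValue_append, pow_add]
  rw [show 2 ^ p.length * 2 ^ r.length + (binValue p * 2 ^ r.length + binValue r)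
    = binValue r + 2 ^ r.length * (2 ^ p.length + binValue p) by ring,
    Nat.add_mul_div_left _ _ (by positivity), Nat.div_eq_of_lt this, zero_add]

lemma DerivedBrick.exists_append_of_index_div {D E : DerivedBrick} {d : ℕ}
    (hl : E.level = D.level + d) (hi : E.index / 2 ^ d = D.index) :
    E.root = D.root ∧ D.path <+: E.path := by
  -- Dropping more digits than the path has would also drop the leading `1` and leave index `0`.
  have hd : d ≤ E.path.length := by
    by_contra hlt
    have h1 := E.index_lt
    have h2 : 2 ^ (E.path.length + 1) ≤ 2 ^ d := Nat.pow_le_pow_right two_pos (by omega)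
    rw [Nat.div_eq_of_lt (by omega)] at hi
    exact D.index_pos.ne hi
  obtain ⟨i, q⟩ := E
  obtain ⟨p, r, rfl, hr⟩ : ∃ p r, q = p ++ r ∧ r.length = d :=
    ⟨q.take (q.length - d), q.drop (q.length - d), by simp, by simp at hd ⊢; omega⟩
  subst hr
  rw [index_div_of_append] at hi
  have : (⟨i, p⟩ : DerivedBrick) = D := by
    refine ext_of_level_index ?_ hi
    rw [level_eq] at hl ⊢
    simp only [List.length_append, Nat.cast_add] at hl ⊢
    omega
  subst this
  exact ⟨rfl, List.prefix_append _ _⟩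

/-! ### Overlaps of derived bricks -/

lemma Brick.interior_region_nonempty (B : Brick) : (interior B.region).Nonempty := by
  have hw := brickWidth_pos B.level
  have hh := brickHeight_pos B.level
  refine ⟨(B.corner.1 + brickWidth B.level / 2, B.corner.2 + brickHeight B.level / 2), ?_⟩
  rw [Brick.region, rect, interior_prod_eq, interior_Icc, interior_Icc]
  constructor <;> constructor <;> simp only <;> linarith

lemma InteriorDisjoint.symm {A B : Set (ℝ × ℝ)} (h : InteriorDisjoint A B) :
    InteriorDisjoint B A := Disjoint.symm h

lemma InteriorDisjoint.mono {A B A' B' : Set (ℝ × ℝ)} (h : InteriorDisjoint A B)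
    (hA : A' ⊆ A) (hB : B' ⊆ B) : InteriorDisjoint A' B' :=
  Disjoint.mono (interior_mono hA) (interior_mono hB) h

lemma Brick.half_interiorDisjoint (B : Brick) :
    InteriorDisjoint (B.half true).region (B.half false).region := by
  unfold Brick.region Brick.half
  by_cases hB : Even B.level
  · apply interiorDisjoint_rect_of_right
    simp [hB, brickWidth_succ]
  · apply interiorDisjoint_rect_of_above
    simp [hB, brickHeight_succ]

lemma foldl_half_interiorDisjoint {p q : List Bool} (B : Brick) (hpq : ¬ p <+: q)
    (hqp : ¬ q <+: p) :
    InteriorDisjoint (p.foldl Brick.half B).region (q.foldl Brick.half B).region := by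
  induction p generalizing q B with
  | nil => exact absurd (List.nil_prefix) hpq
  | cons b p ih =>
    cases q with
    | nil => exact absurd (List.nil_prefix) hqp
    | cons c q =>
      rw [List.foldl_cons, List.foldl_cons]
      by_cases hbc : b = c
      · subst hbc
        rw [List.prefix_cons_inj] at hpq hqp
        exact ih _ hpq hqp
      · have key : InteriorDisjoint (B.half b).region (B.half c).region := by
          cases b <;> cases c <;> simp at hbc
          · exact B.half_interiorDisjoint.symm
          · exact B.half_interiorDisjoint
        exact key.mono (foldl_half_region_subset _ _) (foldl_half_region_subset _ _)

lemma DerivedBrick.region_subset_of_prefix {D E : DerivedBrick} (hr : E.root = D.root)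
    (hp : D.path <+: E.path) : E.region ⊆ D.region := by
  obtain ⟨r, hr'⟩ := hp
  rw [region, region, toBrick, toBrick, ← hr', hr, List.foldl_append]
  exact foldl_half_region_subset _ _

lemma not_interiorDisjoint_of_subset {D E : DerivedBrick} (h : E.region ⊆ D.region) :
    ¬ InteriorDisjoint D.region E.region := by
  intro hd
  obtain ⟨x, hx⟩ := E.toBrick.interior_region_nonempty
  exact Set.disjoint_left.1 hd (interior_mono h hx) hx

/-- Two derived bricks overlap if and only if the corresponding dyadic intervals do. -/
lemma DerivedBrick.interiorDisjoint_iff (D E : DerivedBrick) :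
    InteriorDisjoint D.region E.region ↔ ¬ Nested D.level D.index E.level E.index := by
  constructor
  · rintro hd ⟨d, ⟨hl, hi⟩ | ⟨hl, hi⟩⟩
    · obtain ⟨h1, h2⟩ := exists_append_of_index_div hl hi
      exact not_interiorDisjoint_of_subset (region_subset_of_prefix h1 h2) hd
    · obtain ⟨h1, h2⟩ := exists_append_of_index_div hl hi
      exact not_interiorDisjoint_of_subset (region_subset_of_prefix h1 h2) hd.symm
  · intro hn
    have key : ∀ D E : DerivedBrick, D.root = E.root → D.path <+: E.path →
        Nested D.level D.index E.level E.index := by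
      rintro ⟨i, p⟩ ⟨j, q⟩ hij ⟨r, hr⟩
      simp only at hij hr
      subst hij hr
      refine ⟨r.length, Or.inl ⟨?_, index_div_of_append _ _ _⟩⟩
      simp only [level_eq, List.length_append, Nat.cast_add]
      ring
    rcases lt_trichotomy D.root E.root with h | h | h
    · exact (fundamental_interiorDisjoint h).mono (foldl_half_region_subset _ _)
        (foldl_half_region_subset _ _)
    · rw [region, region, toBrick, toBrick, h]
      exact foldl_half_interiorDisjoint _ (fun hp => hn (key _ _ h hp))
        (fun hp => hn (key _ _ h.symm hp).symm)
    · exact (fundamental_interiorDisjoint h).symm.mono (foldl_half_region_subset _ _)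
        (foldl_half_region_subset _ _)

/-! ### Leftmost allocation of dyadic intervals -/

/-- The dyadic interval `(j, x)` is disjoint from all intervals of the list `A`. -/
def FreeInterval (A : List (ℤ × ℕ)) (j : ℤ) (x : ℕ) : Prop :=
  ∀ e ∈ A, ¬ Nested j x e.1 e.2

lemma freeInterval_append {A : List (ℤ × ℕ)} {k : ℤ} {a : ℕ} {j : ℤ} {x : ℕ} :
    FreeInterval (A ++ [(k, a)]) j x ↔ FreeInterval A j x ∧ ¬ Nested j x k a := by
  simp [FreeInterval, or_imp, forall_and]

/-- An interval that meets a part of a larger dyadic interval meets the larger one; freeness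
therefore passes to subintervals. -/
lemma Nested.of_div {j k : ℤ} {x a d : ℕ} (h : Nested (j + d) x k a) :
    Nested j (x / 2 ^ d) k a := by
  obtain ⟨c, ⟨hk, ha⟩ | ⟨hk, ha⟩⟩ := h
  · refine ⟨d + c, Or.inl ⟨by push_cast; omega, ?_⟩⟩
    rw [← ha, Nat.div_div_eq_div_mul, ← pow_add, add_comm c d]
  · rcases le_total d c with hdc | hdc
    · obtain ⟨c, rfl⟩ := Nat.exists_eq_add_of_le hdc
      refine ⟨c, Or.inr ⟨by push_cast at hk; omega, ?_⟩⟩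
      rw [← ha, Nat.div_div_eq_div_mul, ← pow_add]
    · obtain ⟨d, rfl⟩ := Nat.exists_eq_add_of_le hdc
      refine ⟨d, Or.inl ⟨by push_cast at hk; omega, ?_⟩⟩
      rw [← ha, Nat.div_div_eq_div_mul, ← pow_add]

lemma FreeInterval.descendant {A : List (ℤ × ℕ)} {j : ℤ} {x d : ℕ}
    (h : FreeInterval A j (x / 2 ^ d)) : FreeInterval A (j + d) x :=
  fun e he hn => h e he hn.of_div

/-- Among the maximal free intervals, there is at most one of each length. -/
def UniqueMaximalFree (A : List (ℤ × ℕ)) : Prop :=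
  ∀ (j : ℤ) (x y : ℕ), 1 ≤ x → x < y → FreeInterval A (j + 1) x → FreeInterval A (j + 1) y →
    FreeInterval A j (y / 2)

lemma uniqueMaximalFree_nil : UniqueMaximalFree [] := by
  intro j x y _ _ _ _ e he
  simp at he

/-- If the new interval destroys freeness of the parent of `y` but spares `y`, it lies in the
sibling of `y`. It also spares `x`, so that sibling is to the right of `x`, and the leftmost cell of
level `k` inside `x` would have been chosen instead. -/
lemma UniqueMaximalFree.append {A : List (ℤ × ℕ)} (hA : UniqueMaximalFree A) {k : ℤ} {a : ℕ}
    (hmin : ∀ z, 1 ≤ z → FreeInterval A k z → a ≤ z) :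
    UniqueMaximalFree (A ++ [(k, a)]) := by
  intro j x y hx hxy hfx hfy
  rw [freeInterval_append] at hfx hfy ⊢
  refine ⟨hA j x y hx hxy hfx.1 hfy.1, ?_⟩
  rintro ⟨d, ⟨hk, ha⟩ | ⟨hk, ha⟩⟩
  · rcases d with _ | d
    · simp only [Nat.cast_zero, add_zero, pow_zero, Nat.div_one] at hk ha
      exact hfy.2 ⟨1, Or.inr ⟨by push_cast; omega, by simp [ha]⟩⟩
    · rw [pow_succ, ← Nat.div_div_eq_div_mul] at ha
      have hk' : k = j + 1 + d := by push_cast at hk; omega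
      have hax : a / 2 ^ d ≠ x := fun h => hfx.2 ⟨d, Or.inl ⟨hk', h⟩⟩
      have hay : a / 2 ^ d ≠ y := fun h => hfy.2 ⟨d, Or.inl ⟨hk', h⟩⟩
      have hlt : x + 1 ≤ a / 2 ^ d := by omega
      have hle : a ≤ x * 2 ^ d := by
        refine hmin _ (Nat.mul_pos hx (by positivity)) ?_
        rw [hk']
        apply FreeInterval.descendant
        rw [Nat.mul_div_cancel _ (by positivity)]
        exact hfx.1
      rw [Nat.le_div_iff_mul_le (by positivity)] at hlt
      have : 0 < 2 ^ d := by positivity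
      rw [add_mul] at hlt
      omega
  · refine hfy.2 ⟨d + 1, Or.inr ⟨by push_cast; omega, ?_⟩⟩
    rw [pow_succ', ← Nat.div_div_eq_div_mul, ha]

open Classical in
/-- If no interval of level `k` to the left of `(k, n)` is free, then the number of free
intervals of level `k + d` there is smaller than `2 ^ d`. -/
lemma card_free_lt {A : List (ℤ × ℕ)} (hA : UniqueMaximalFree A) {k : ℤ} {n : ℕ}
    (hn : ∀ z, 1 ≤ z → z < n → ¬ FreeInterval A k z) (d : ℕ) :
    ((Finset.Ico 1 (n * 2 ^ d)).filter fun x => FreeInterval A (k + d) x).card + 1 ≤ 2 ^ d := by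
  induction d with
  | zero =>
    simp only [pow_zero, mul_one, Nat.cast_zero, add_zero]
    rw [Finset.filter_false_of_mem]
    · simp
    · intro x hx
      rw [Finset.mem_Ico] at hx
      exact hn x hx.1 hx.2
  | succ d ih =>
    set E := (Finset.Ico 1 (n * 2 ^ (d + 1))).filter
      fun x => FreeInterval A (k + (d + 1 : ℕ)) x with hE
    set F := (Finset.Ico 1 (n * 2 ^ d)).filter fun x => FreeInterval A (k + d) x with hF
    have hmem : ∀ y ∈ E, 1 ≤ y ∧ y < n * 2 ^ (d + 1) ∧ FreeInterval A (k + d + 1) y := by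
      intro y hy
      rw [hE, Finset.mem_filter, Finset.mem_Ico] at hy
      exact ⟨hy.1.1, hy.1.2, by simpa [add_assoc] using hy.2⟩
    -- Every free interval except the leftmost has a free parent. Passing to the next level thus at
    -- most doubles the count and adds one, which is how `2 ^ d - 1` grows.
    have h1 : (E.filter fun y => ¬ y / 2 ∈ F).card ≤ 1 := by
      have key : ∀ x y, x ∈ E → y ∈ E → x < y → y / 2 ∈ F := by
        intro x y hx hy hxy
        obtain ⟨hx1, -, hx3⟩ := hmem x hx
        obtain ⟨-, hy2, hy3⟩ := hmem y hy
        rw [hF, Finset.mem_filter, Finset.mem_Ico]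
        rw [pow_succ, ← mul_assoc] at hy2
        exact ⟨⟨by omega, by omega⟩, hA _ x y hx1 hxy hx3 hy3⟩
      rw [Finset.card_le_one]
      intro x hx y hy
      rw [Finset.mem_filter] at hx hy
      rcases lt_trichotomy x y with h | h | h
      · exact absurd (key x y hx.1 hy.1 h) hy.2
      · exact h
      · exact absurd (key y x hy.1 hx.1 h) hx.2
    have h2 : (E.filter fun y => y / 2 ∈ F).card ≤ 2 * F.card := by
      refine Finset.card_le_mul_card_image_of_maps_to (f := fun y => y / 2)
        (fun y hy => (Finset.mem_filter.1 hy).2) 2 ?_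
      intro b _
      refine (Finset.card_le_card (t := {2 * b, 2 * b + 1}) ?_).trans Finset.card_le_two
      intro y hy
      have := (Finset.mem_filter.1 hy).2
      simp only [Finset.mem_insert, Finset.mem_singleton]
      omega
    have h3 := Finset.card_filter_add_card_filter_not (s := E) (fun y => y / 2 ∈ F)
    rw [pow_succ]
    omega

lemma card_filter_exists_le {α : Type*} (s : Finset ℕ) (A : List α) (P : α → ℕ → Prop)
    [∀ e, DecidablePred (P e)] (c : α → ℕ) (h : ∀ e ∈ A, (s.filter (P e)).card ≤ c e) :
    (s.filter fun x => ∃ e ∈ A, P e x).card ≤ (A.map c).sum := by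
  induction A with
  | nil => simp
  | cons e A ih =>
    have hsub : (s.filter fun x => ∃ f ∈ e :: A, P f x) ⊆
        s.filter (P e) ∪ s.filter fun x => ∃ f ∈ A, P f x := by
      intro x
      simp only [Finset.mem_filter, Finset.mem_union, List.mem_cons, exists_eq_or_imp]
      tauto
    have h1 := (Finset.card_le_card hsub).trans (Finset.card_union_le _ _)
    have h2 := h e (by simp)
    have h3 := ih fun f hf => h f (by simp [hf])
    rw [List.map_cons, List.sum_cons]
    omega

/-- If no interval of level `k` to the left of `(k, n)` is free, then the allocated intervals have
total length at least `(n - 1) 2⁻ᵏ`. -/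
lemma le_sum_length {A : List (ℤ × ℕ)} (hA : UniqueMaximalFree A) {k : ℤ} {n : ℕ} (hn0 : 1 ≤ n)
    (hn : ∀ z, 1 ≤ z → z < n → ¬ FreeInterval A k z) :
    ((n : ℝ) - 1) * (2 : ℝ) ^ (-k) ≤ (A.map fun e => (2 : ℝ) ^ (-e.1)).sum := by
  classical
  -- At level `k + d` every allocated interval is a union of cells, so lengths become cell counts.
  -- The bound `e.1 ≤ k + d` also ensures that `toNat` below truncates nothing.
  obtain ⟨d, hd⟩ : ∃ d : ℕ, ∀ e ∈ A, e.1 ≤ k + d := by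
    clear hA hn
    induction A with
    | nil => exact ⟨0, by simp⟩
    | cons e A ih =>
      obtain ⟨d, hd⟩ := ih
      refine ⟨d + (e.1 - k).toNat, fun f hf => ?_⟩
      rcases List.mem_cons.1 hf with rfl | hf
      · push_cast; omega
      · have := hd f hf; push_cast; omega
  have h1 := card_free_lt hA hn d
  have h2 := Finset.card_filter_add_card_filter_not (s := Finset.Ico 1 (n * 2 ^ d))
    (fun x => FreeInterval A (k + d) x)
  have h3 : ((Finset.Ico 1 (n * 2 ^ d)).filter fun x => ¬ FreeInterval A (k + d) x).card ≤
      (A.map fun e => 2 ^ (k + d - e.1).toNat).sum := by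
    refine le_trans (Finset.card_le_card ?_) (card_filter_exists_le (Finset.Ico 1 (n * 2 ^ d)) A
      (fun e x => x / 2 ^ (k + d - e.1).toNat = e.2) _ fun e _ => ?_)
    · intro x hx
      rw [Finset.mem_filter] at hx ⊢
      refine ⟨hx.1, ?_⟩
      have hx2 := hx.2
      unfold FreeInterval at hx2
      push Not at hx2
      obtain ⟨e, he, c, ⟨hc, hx⟩ | ⟨hc, hx⟩⟩ := hx2
      · have := hd e he
        obtain rfl : c = 0 := by omega
        refine ⟨e, he, ?_⟩
        rw [show (k + d - e.1).toNat = 0 by omega]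
        simpa using hx.symm
      · exact ⟨e, he, by rw [show (k + d - e.1).toNat = c by omega]; exact hx⟩
    · refine (Finset.card_le_card (t := Finset.Ico (e.2 * 2 ^ (k + d - e.1).toNat)
        (e.2 * 2 ^ (k + d - e.1).toNat + 2 ^ (k + d - e.1).toNat)) ?_).trans (by simp)
      intro x hx
      have := (Finset.mem_filter.1 hx).2
      have hp : 0 < 2 ^ (k + d - e.1).toNat := by positivity
      rw [Finset.mem_Ico, ← this]
      exact ⟨Nat.div_mul_le_self _ _, Nat.lt_div_mul_add hp⟩
  rw [Nat.card_Ico] at h2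
  -- There are `n 2ᵈ - 1` cells, as index `0` is excluded, and at most `2ᵈ - 1` are free. The two
  -- units cancel, which gives exactly `n - 1` in the conclusion.
  have h4 : n * 2 ^ d ≤ (A.map fun e => 2 ^ (k + d - e.1).toNat).sum + 2 ^ d := by
    have : 1 ≤ n * 2 ^ d := Nat.mul_pos hn0 (by positivity)
    omega
  have h5 : (((A.map fun e => 2 ^ (k + d - e.1).toNat).sum : ℕ) : ℝ) =
      (2 : ℝ) ^ (k + d) * (A.map fun e => (2 : ℝ) ^ (-e.1)).sum := by
    rw [Nat.cast_list_sum, List.map_map, ← List.sum_map_mul_left]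
    congr 1
    refine List.map_congr_left fun e he => ?_
    have := hd e he
    simp only [Function.comp, Nat.cast_pow, Nat.cast_ofNat]
    rw [← zpow_natCast, ← zpow_add₀ (by norm_num)]
    congr 1
    omega
  have h6 : (n : ℝ) * 2 ^ d ≤ ((A.map fun e => 2 ^ (k + d - e.1).toNat).sum : ℕ) + 2 ^ d := by
    exact_mod_cast h4
  rw [h5] at h6
  have h7 : (2 : ℝ) ^ d = 2 ^ (k + d) * 2 ^ (-k) := by
    rw [← zpow_natCast, ← zpow_add₀ (by norm_num)]
    congr 1
    ring
  rw [h7] at h6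
  have h8 : (0 : ℝ) < 2 ^ (k + d) := by positivity
  refine le_of_mul_le_mul_left ?_ h8
  linarith

/-! ### BrickTranslation on squares -/

lemma sqrt_two_zpow_pos (k : ℤ) : 0 < (Real.sqrt 2) ^ k := by positivity

lemma sqrt_two_zpow_mul_self (k : ℤ) :
    (Real.sqrt 2) ^ k * (Real.sqrt 2) ^ k = 2 ^ k := by
  rw [← mul_zpow, Real.mul_self_sqrt (by norm_num)]

lemma Suitable.square {k : ℤ} {p : Piece} (h : Suitable k p) (hp : p.width = p.height) :
    (Real.sqrt 2) ^ (-k) / 2 < p.width ∧ p.width ≤ (Real.sqrt 2) ^ (-k - 1) := by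
  obtain ⟨⟨h1, h2⟩, h3⟩ := h
  constructor
  · by_contra hle
    push Not at hle
    rw [← sqrt_two_zpow_half] at hle
    exact h3 ⟨hle.trans (le_brickWidth _), hp ▸ hle.trans (le_brickHeight _)⟩
  · unfold brickWidth brickHeight at *
    split_ifs at h1 h2
    · rw [hp]; exact h2
    · exact h1

/-- Each square pays for a quarter of the length `2⁻ᵏ` of its dyadic interval; this is how allocated
length is charged to area. -/
lemma Suitable.square_area {k : ℤ} {p : Piece} (h : Suitable k p) (hp : p.width = p.height) :
    (2 : ℝ) ^ (-k) / 4 ≤ p.width ^ 2 := by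
  have h1 := (h.square hp).1
  have h2 := sqrt_two_zpow_mul_self (-k)
  have h3 := sqrt_two_zpow_pos (-k)
  nlinarith

lemma le_of_rect_subset {c d : ℝ × ℝ} {w h w' h' : ℝ} (hw : 0 ≤ w) (hh : 0 ≤ h)
    (hs : rect c w h ⊆ rect d w' h') :
    d.1 ≤ c.1 ∧ c.1 + w ≤ d.1 + w' ∧ d.2 ≤ c.2 ∧ c.2 + h ≤ d.2 + h' := by
  have h1 : c ∈ rect d w' h' := hs ⟨⟨le_rfl, by linarith⟩, ⟨le_rfl, by linarith⟩⟩
  have h2 : (c.1 + w, c.2 + h) ∈ rect d w' h' :=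
    hs ⟨⟨by simpa, le_rfl⟩, ⟨by simpa, le_rfl⟩⟩
  exact ⟨h1.1.1, h2.1.2, h1.2.1, h2.2.2⟩

/-- The dyadic intervals that correspond to the bricks of a state. -/
def State.intervals (S : State) : List (ℤ × ℕ) := S.map fun q => (q.2.level, q.2.index)

/-- The total area of the squares placed in a state. -/
def State.area (S : State) : ℝ := (S.map fun q => q.1.piece.width ^ 2).sum

lemma freeInterval_intervals {S : State} {D : DerivedBrick} :
    FreeInterval S.intervals D.level D.index ↔ IsFree S.bricks D := by
  simp only [FreeInterval, State.intervals, IsFree, State.bricks, List.forall_mem_map,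
    DerivedBrick.interiorDisjoint_iff]

/-- The properties of the states reached by BrickTranslation on streams of squares. -/
structure SquareState (S : State) : Prop where
  square : ∀ q ∈ S, q.1.piece.width = q.1.piece.height
  suitable : ∀ q ∈ S, Suitable q.2.level q.1.piece
  corner : ∀ q ∈ S, q.1.corner = q.2.toBrick.corner
  disjoint : S.Pairwise fun q r => InteriorDisjoint q.2.region r.2.region
  maximalFree : UniqueMaximalFree S.intervals
  -- When the brick of `q` was opened, no brick of its level with smaller index was free, so the
  -- earlier squares already had area at least the first summand.
  area : ∀ q ∈ S, ((q.2.index : ℝ) - 1) * 2 ^ (-q.2.level) / 4 + q.1.piece.width ^ 2 ≤ S.area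

lemma squareState_nil : SquareState [] where
  square := by simp
  suitable := by simp
  corner := by simp
  disjoint := List.Pairwise.nil
  maximalFree := uniqueMaximalFree_nil
  area := by simp

lemma State.exists_mem_of_mem_bricks {S : State} {D : DerivedBrick} (hD : D ∈ S.bricks) :
    ∃ q ∈ S, q.2 = D := by
  simpa [bricks] using hD

/-- A brick holding one square of the suitable size has no room for a second one. -/
lemma SquareState.not_hasRoom {S : State} (hS : SquareState S) {D : DerivedBrick}
    (hD : D ∈ S.bricks) {p : Piece} (hp : p.width = p.height) (hk : Suitable D.level p) :
    ¬ S.HasRoom D p := by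
  intro hroom
  obtain ⟨q, hq, rfl⟩ := State.exists_mem_of_mem_bricks hD
  have hmem : q.1.piece ∈ S.piecesIn q.2 := by
    simp only [State.piecesIn, List.mem_map, List.mem_filter, decide_eq_true_eq]
    exact ⟨q, ⟨hq, rfl⟩, rfl⟩
  have hqs := ((hS.suitable q hq).square (hS.square q hq)).1
  have hps := (hk.square hp).1
  obtain ⟨-, h2, -, h4⟩ := le_of_rect_subset p.width_pos.le p.height_pos.le hroom
  -- Both sides exceed half of `√2⁻ᵏ`, so two stacked squares exceed the short side `√2⁻ᵏ⁻¹` of the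
  -- brick, along which the stack grows.
  have hlt : (Real.sqrt 2) ^ (-q.2.level - 1) < (Real.sqrt 2) ^ (-q.2.level) :=
    zpow_lt_zpow_right₀ one_lt_sqrt_two (by omega)
  have hlev : q.2.toBrick.level = q.2.level := rfl
  rw [hlev] at h2 h4
  simp only [State.nextCorner] at h2 h4
  by_cases he : Even q.2.level
  · simp only [he, if_true, brickHeight] at h4
    have hsum : q.1.piece.height ≤ ((S.piecesIn q.2).map Piece.height).sum := by
      refine List.single_le_sum (fun x hx => ?_) _ (List.mem_map_of_mem hmem)
      obtain ⟨r, -, rfl⟩ := List.mem_map.1 hx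
      exact r.height_pos.le
    have := hS.square q hq
    linarith
  · simp only [he, if_false, brickWidth] at h2
    have hsum : q.1.piece.width ≤ ((S.piecesIn q.2).map Piece.width).sum := by
      refine List.single_le_sum (fun x hx => ?_) _ (List.mem_map_of_mem hmem)
      obtain ⟨r, -, rfl⟩ := List.mem_map.1 hx
      exact r.width_pos.le
    linarith

lemma suitable_suitableLevel (p : Piece) : Suitable (suitableLevel p) p :=
  Classical.choose_spec (exists_suitable p)

lemma isMinFree_minFree (k : ℤ) (𝒟 : List DerivedBrick) : IsMinFree k 𝒟 (minFree k 𝒟) :=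
  Classical.choose_spec (exists_isMinFree k 𝒟)

lemma SquareState.chooseBrick_eq {S : State} (hS : SquareState S) {p : Piece}
    (hp : p.width = p.height) : S.chooseBrick p = minFree (suitableLevel p) S.bricks := by
  unfold State.chooseBrick
  split
  · rename_i D hD
    have h1 := List.find?_some hD
    have h2 := List.mem_of_find?_eq_some hD
    simp only [decide_eq_true_eq] at h1
    exact absurd h1.2 (hS.not_hasRoom h2 hp (h1.1 ▸ suitable_suitableLevel p))
  · rfl

/-- A free brick cannot already be in use, since it overlaps itself; its stack is empty. -/
lemma State.nextCorner_of_isFree {S : State} {D : DerivedBrick} (hD : IsFree S.bricks D) :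
    S.nextCorner D = D.toBrick.corner := by
  have : S.piecesIn D = [] := by
    simp only [State.piecesIn, List.map_eq_nil_iff, List.filter_eq_nil_iff, decide_eq_true_eq]
    rintro q hq rfl
    exact not_interiorDisjoint_of_subset subset_rfl
      (hD q.2 (List.mem_map_of_mem hq))
  simp [State.nextCorner, this]

lemma SquareState.brickStep_eq {S : State} (hS : SquareState S) {p : Piece}
    (hp : p.width = p.height) :
    brickStep S p = S ++ [(⟨p, (minFree (suitableLevel p) S.bricks).toBrick.corner⟩,
      minFree (suitableLevel p) S.bricks)] := by
  rw [brickStep, hS.chooseBrick_eq hp, State.packIn,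
    State.nextCorner_of_isFree (isMinFree_minFree _ _).1.2]

lemma IsMinFree.index_le {k : ℤ} {S : State} {D : DerivedBrick} (hD : IsMinFree k S.bricks D)
    {n : ℕ} (hn : 1 ≤ n) (hf : FreeInterval S.intervals k n) : D.index ≤ n := by
  obtain ⟨E, hE, rfl⟩ := DerivedBrick.exists_level_index k hn
  rw [← hE, freeInterval_intervals] at hf
  rcases hD.2 E hE hf with rfl | h
  · exact le_rfl
  · exact (DerivedBrick.index_lt_of_prec (hD.1.1.trans hE.symm) h).le

lemma SquareState.brickStep {S : State} (hS : SquareState S) {p : Piece}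
    (hp : p.width = p.height) : SquareState (brickStep S p) := by
  rw [hS.brickStep_eq hp]
  set D := minFree (suitableLevel p) S.bricks with hD
  have hmin : IsMinFree (suitableLevel p) S.bricks D := isMinFree_minFree _ _
  have hlev : D.level = suitableLevel p := hmin.1.1
  have hsuit : Suitable D.level p := hlev ▸ suitable_suitableLevel p
  have harea : State.area (S ++ [(⟨p, D.toBrick.corner⟩, D)]) = S.area + p.width ^ 2 := by
    simp [State.area]
  have hint : State.intervals (S ++ [(⟨p, D.toBrick.corner⟩, D)]) =
      S.intervals ++ [(D.level, D.index)] := by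
    simp [State.intervals]
  refine ⟨?_, ?_, ?_, ?_, ?_, ?_⟩
  · intro q hq
    rcases List.mem_append.1 hq with hq | hq
    · exact hS.square q hq
    · rw [List.mem_singleton.1 hq]; exact hp
  · intro q hq
    rcases List.mem_append.1 hq with hq | hq
    · exact hS.suitable q hq
    · rw [List.mem_singleton.1 hq]; exact hsuit
  · intro q hq
    rcases List.mem_append.1 hq with hq | hq
    · exact hS.corner q hq
    · rw [List.mem_singleton.1 hq]
  · rw [List.pairwise_append]
    refine ⟨hS.disjoint, List.pairwise_singleton _ _, fun q hq r hr => ?_⟩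
    rw [List.mem_singleton.1 hr]
    exact (hmin.1.2 q.2 (List.mem_map_of_mem hq)).symm
  · rw [hint]
    refine hS.maximalFree.append fun z hz hf => hmin.index_le hz ?_
    rwa [← hlev]
  · intro q hq
    rw [harea]
    rcases List.mem_append.1 hq with hq | hq
    · have := hS.area q hq
      nlinarith [sq_nonneg p.width]
    · rw [List.mem_singleton.1 hq]
      -- Minimality of `D` says that no smaller index of its level is free, as `le_sum_length`
      -- requires.
      have h1 := le_sum_length hS.maximalFree (k := D.level) D.index_pos
        (fun z hz hlt hf => (hmin.index_le hz (hlev ▸ hf)).not_gt hlt)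
      have h2 : (S.intervals.map fun e => (2 : ℝ) ^ (-e.1)).sum ≤ 4 * S.area := by
        rw [State.intervals, State.area, List.map_map, ← List.sum_map_mul_left]
        refine List.sum_le_sum fun q hq => ?_
        have := (hS.suitable q hq).square_area (hS.square q hq)
        simp only [Function.comp]
        linarith
      simp only
      linarith

lemma squareState_foldl {L : List Piece} (hL : ∀ p ∈ L, p.width = p.height) :
    SquareState (L.foldl brickStep []) := by
  induction L using List.reverseRecOn with
  | nil => exact squareState_nil
  | append_singleton L p ih =>
    rw [List.foldl_append]
    exact (ih fun q hq => hL q (by simp [hq])).brickStep (hL p (by simp))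

lemma map_piece_foldl (L : List Piece) :
    (L.foldl brickStep []).map (fun q => q.1.piece) = L := by
  induction L using List.reverseRecOn with
  | nil => rfl
  | append_singleton L p ih =>
    rw [List.foldl_append, List.foldl_cons, List.foldl_nil, brickStep, State.packIn,
      List.map_append, ih]
    simp

lemma SquareState.region_subset {S : State} (hS : SquareState S) {q : PlacedPiece × DerivedBrick}
    (hq : q ∈ S) : q.1.region ⊆ q.2.region := by
  obtain ⟨h1, h2⟩ := (hS.suitable q hq).1
  rw [PlacedPiece.region, hS.corner q hq]
  exact rect_subset le_rfl (add_le_add_right h1 _) le_rfl (add_le_add_right h2 _)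

/-- BrickTranslation produces a packing of every stream of squares. -/
theorem isPackingOf_brickTranslation {L : List Piece} (hL : ∀ p ∈ L, p.width = p.height) :
    IsPackingOf (brickTranslation L) L := by
  have hS := squareState_foldl hL
  refine ⟨?_, ?_⟩
  · rw [brickTranslation, List.map_map]
    exact map_piece_foldl L
  · rw [brickTranslation, List.pairwise_map]
    refine hS.disjoint.imp_of_mem fun hq hr h => h.mono ?_ ?_
    · exact hS.region_subset hq
    · exact hS.region_subset hr

/-- The total area of a stream of squares. -/
def squaresArea (L : List Piece) : ℝ := (L.map fun p => p.width ^ 2).sum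

lemma area_foldl (L : List Piece) : State.area (L.foldl brickStep []) = squaresArea L := by
  conv_rhs => rw [← map_piece_foldl L]
  rw [squaresArea, List.map_map]
  rfl

/-! ### The extent of the packing -/

/-- The number with binary expansion `0.b₂b₄b₆⋯`, where `b₁, b₂, …` is the given list. -/
def evenDigits : List Bool → ℝ
  | [] => 0
  | [_] => 0
  | _ :: c :: l => ((c.toNat : ℝ) + evenDigits l) / 2

/-- Below a brick of even level, the halvings at odd positions of the path cut the width and those
at even positions the height, so only the latter move the second coordinate. For odd level the axes
are exchanged. -/
lemma foldl_half_corner_of_even (l : List Bool) (B : Brick) (hB : Even B.level) :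
    (l.foldl Brick.half B).corner.2 = B.corner.2 + brickHeight B.level * evenDigits l := by
  induction l using evenDigits.induct generalizing B with
  | case1 => simp [evenDigits]
  | case2 b => cases b <;> simp [evenDigits, Brick.half, hB]
  | case3 b c l ih =>
    have h1 : ¬ Even (B.level + 1) := by simpa [Int.even_add_one] using hB
    have h2 : Even (B.level + 1 + 1) := by simpa [Int.even_add_one] using hB
    rw [List.foldl_cons, List.foldl_cons, ih _ h2]
    simp only [evenDigits, Brick.half, hB, h1, brickHeight_succ, if_true, if_false]
    cases b <;> cases c <;> simp <;> ring

lemma foldl_half_corner_of_odd (l : List Bool) (B : Brick) (hB : ¬ Even B.level) :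
    (l.foldl Brick.half B).corner.1 = B.corner.1 + brickWidth B.level * evenDigits l := by
  induction l using evenDigits.induct generalizing B with
  | case1 => simp [evenDigits]
  | case2 b => cases b <;> simp [evenDigits, Brick.half, hB]
  | case3 b c l ih =>
    have h1 : Even (B.level + 1) := by simpa [Int.even_add_one] using hB
    have h2 : ¬ Even (B.level + 1 + 1) := by simpa [Int.even_add_one] using hB
    rw [List.foldl_cons, List.foldl_cons, ih _ h2]
    simp only [evenDigits, Brick.half, hB, h1, brickWidth_succ, if_true, if_false]
    cases b <;> cases c <;> simp <;> ring

/-- A binary fraction `X` dominates its even digits; `e` is the place value of the last of them,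
and `2⁻ˡ` is the place value of the last digit of `X`. -/
lemma evenDigits_bound (l : List Bool) :
    ∃ e : ℝ, 0 < e ∧ 0 ≤ evenDigits l ∧ evenDigits l + e ≤ 1 ∧
      (evenDigits l + e) ^ 2 ≤ 3 * (binValue l / 2 ^ l.length) + e ^ 2 ∧
      (((2 : ℝ) ^ l.length)⁻¹ = e ^ 2 ∨ ((2 : ℝ) ^ l.length)⁻¹ = e ^ 2 / 2 ) := by
  induction l using evenDigits.induct with
  | case1 => exact ⟨1, by norm_num [evenDigits, binValue]⟩
  | case2 b => exact ⟨1, by cases b <;> norm_num [evenDigits, binValue]⟩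
  | case3 b c l ih =>
    obtain ⟨e, he, h1, h2, h3, h4⟩ := ih
    have hX : (binValue (b :: c :: l) : ℝ) / 2 ^ (b :: c :: l).length =
        b.toNat / 2 + c.toNat / 4 + (binValue l / 2 ^ l.length) / 4 := by
      have : (2 : ℝ) ^ l.length ≠ 0 := by positivity
      simp only [binValue, List.length_cons]
      push_cast
      field_simp
      ring
    have hb : (0 : ℝ) ≤ b.toNat := Nat.cast_nonneg _
    refine ⟨e / 2, by positivity, ?_, ?_, ?_, ?_⟩
    · simp only [evenDigits]; positivity
    · cases c <;> simp [evenDigits] <;> linarith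
    -- Four times the left side is `(c + Y + e)² = c + 2c(Y + e) + (Y + e)² ≤ 3c + 3X + e²`, by `Y +
    -- e ≤ 1`. Equality persists when `b = 0`, `c = 1` and `Y + e = 1`: the path `1, 2, 1, 2, …` of
    -- the tight stream.
    · rw [hX]
      cases c <;> simp only [evenDigits, Bool.toNat_true, Bool.toNat_false] <;> push_cast <;>
        nlinarith
    · simp only [List.length_cons, pow_succ, mul_inv]
      rcases h4 with h4 | h4
      · left; rw [h4]; ring
      · right; rw [h4]; ring

/-- The numerical inequality behind the competitive ratio `6`. -/
lemma extent_inequality {X Y e δ τ : ℝ} (he : 0 < e) (hY : 0 ≤ Y) (hYe : Y + e ≤ 1)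
    (hX : (Y + e) ^ 2 ≤ 3 * X + e ^ 2) (hδ : δ = e ^ 2 ∨ δ = e ^ 2 / 2) (hτ : 0 ≤ τ)
    (h1 : δ / 2 ≤ τ ^ 2) (h2 : τ ^ 2 ≤ δ) :
    (1 + Y + τ) ^ 2 ≤ 3 * (1 + X - δ) + 6 * τ ^ 2 := by
  -- With `W = Y + e` and `τ = e - u`, the left side is `(1 + W - u)²`, and the hypothesis `hX`
  -- reads `W² ≤ 3X + e²`.
  obtain ⟨u, rfl⟩ : ∃ u, τ = e - u := ⟨e - τ, by ring⟩
  obtain ⟨W, rfl⟩ : ∃ W, Y = W - e := ⟨Y + e, by ring⟩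
  have he1 : e ≤ 1 := by linarith
  have hW : W ≤ 1 := by linarith
  rcases hδ with rfl | rfl
  · have hu0 : 0 ≤ u := by nlinarith
    -- The constant lies between `1 - 1/√2 ≈ 0.293`, which is what `τ² ≥ e²/2` gives, and the
    -- smaller root `≈ 0.310` of `2 - 8t + 5t²`, which `k3` needs. The claim then follows by adding
    -- `2·k1 + 4·k2 + k3`.
    have hu1 : u ≤ 3 / 10 * e := by nlinarith
    have k1 : 0 ≤ (1 - W) * (1 - u) := mul_nonneg (by linarith) (by linarith)
    have k2 : 0 ≤ u * (1 - e) := mul_nonneg hu0 (by linarith)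
    have k3 : 0 ≤ 2 * e ^ 2 - 8 * u * e + 5 * u ^ 2 := by nlinarith
    nlinarith
  -- Here the remaining quadratic form `(7/2)e² - 8ue + 5u²` is positive definite.
  · have hu0 : e / 4 ≤ u := by nlinarith
    have hu1 : u ≤ e / 2 := by nlinarith
    have k1 : 0 ≤ (1 - W) * (1 - u) := mul_nonneg (by linarith) (by linarith)
    have k2 : e / 4 * (1 - e) ≤ u * (1 - e) := mul_le_mul_of_nonneg_right hu0 (by linarith)
    nlinarith

lemma fundamentalBrick_region_even {K : ℤ} (hK : Even K) :
    (fundamentalBrick K).region =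
      rect (0, (Real.sqrt 2) ^ (-K - 1)) ((Real.sqrt 2) ^ (-K)) ((Real.sqrt 2) ^ (-K - 1)) := by
  simp [Brick.region, fundamentalBrick, brickWidth, brickHeight, hK]

lemma fundamentalBrick_region_odd {K : ℤ} (hK : ¬ Even K) :
    (fundamentalBrick K).region =
      rect ((Real.sqrt 2) ^ (-K - 1), 0) ((Real.sqrt 2) ^ (-K - 1)) ((Real.sqrt 2) ^ (-K)) := by
  simp [Brick.region, fundamentalBrick, brickWidth, brickHeight, hK]

/-- All squares packed by BrickTranslation lie in a square of six times their total area. -/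
lemma SquareState.region_subset_rect {S : State} (hS : SquareState S)
    {q : PlacedPiece × DerivedBrick} (hq : q ∈ S) :
    q.1.region ⊆ rect (0, 0) (Real.sqrt (6 * S.area)) (Real.sqrt (6 * S.area)) := by
  have harea := hS.area q hq
  have hsq := hS.square q hq
  have hlow := (hS.suitable q hq).square_area hsq
  have hup := ((hS.suitable q hq).square hsq).2
  have hroot : q.1.region ⊆ (fundamentalBrick q.2.root).region :=
    (hS.region_subset hq).trans (foldl_half_region_subset _ _)
  have hcorner := hS.corner q hq
  obtain ⟨⟨p, c⟩, ⟨K, l⟩⟩ := q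
  simp only [PlacedPiece.region] at *
  obtain ⟨e, he, hY, hYe, hX, hδ⟩ := evenDigits_bound l
  set Y := evenDigits l
  set X : ℝ := binValue l / 2 ^ l.length with hXdef
  set δ : ℝ := ((2 : ℝ) ^ l.length)⁻¹ with hδdef
  set H : ℝ := (Real.sqrt 2) ^ (-K - 1) with hH
  set G : ℝ := (Real.sqrt 2) ^ (-K) with hG
  have hHpos : 0 < H := sqrt_two_zpow_pos _
  have hδpos : 0 < δ := by positivity
  have hGsq : G ^ 2 = 2 * H ^ 2 := by
    rw [sq, sq, hG, hH, sqrt_two_zpow_mul_self, sqrt_two_zpow_mul_self, zpow_sub_one₀ (by norm_num)]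
    ring
  have hlev : (2 : ℝ) ^ (-(DerivedBrick.level ⟨K, l⟩)) = 2 * H ^ 2 * δ := by
    rw [← hGsq, sq, hG, sqrt_two_zpow_mul_self, DerivedBrick.level_eq, neg_add,
      zpow_add₀ (by norm_num), zpow_neg _ (l.length : ℤ), zpow_natCast]
  have hidx : ((DerivedBrick.index ⟨K, l⟩ : ℝ) - 1) * δ = 1 + X - δ := by
    rw [hδdef, hXdef, DerivedBrick.index]
    push_cast
    field_simp
  have hup2 : p.width ^ 2 ≤ H ^ 2 * δ := by
    have h1 : p.width ^ 2 ≤ ((Real.sqrt 2) ^ (-(DerivedBrick.level ⟨K, l⟩) - 1)) ^ 2 :=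
      pow_le_pow_left₀ p.width_pos.le hup 2
    rw [sq (Real.sqrt 2 ^ _), sqrt_two_zpow_mul_self, zpow_sub_one₀ (by norm_num), hlev] at h1
    linarith
  rw [hlev] at harea hlow
  -- After scaling by `H`, the short side of `B_K`, the area invariant involves only `X`, `δ` and
  -- the square.
  have hA : H ^ 2 * (1 + X - δ) / 2 + p.width ^ 2 ≤ S.area := by
    rw [← hidx]; linarith
  have hX0 : 0 ≤ X := by positivity
  obtain ⟨τ, hτ⟩ : ∃ τ, p.width = H * τ := ⟨p.width / H, by field_simp⟩
  have hτ0 : 0 ≤ τ := by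
    have := p.width_pos
    rw [hτ] at this
    exact (pos_of_mul_pos_right this hHpos.le).le
  have hH2 : 0 < H ^ 2 := by positivity
  -- Along its long side, `B_K` starts at `0` and ends at `G`, so the trivial containment in `B_K`
  -- suffices in that direction.
  have hshort : G ≤ Real.sqrt (6 * S.area) := by
    apply Real.le_sqrt_of_sq_le
    rw [hGsq]
    nlinarith
  have hlong : H + H * Y + p.width ≤ Real.sqrt (6 * S.area) := by
    have key := extent_inequality he hY hYe hX hδ hτ0
      (by rw [hτ, mul_pow] at hlow; nlinarith) (by rw [hτ, mul_pow] at hup2; nlinarith)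
    apply Real.le_sqrt_of_sq_le
    rw [hτ] at hA ⊢
    calc (H + H * Y + H * τ) ^ 2 = H ^ 2 * (1 + Y + τ) ^ 2 := by ring
      _ ≤ H ^ 2 * (3 * (1 + X - δ) + 6 * τ ^ 2) := mul_le_mul_of_nonneg_left key hH2.le
      _ = 6 * (H ^ 2 * (1 + X - δ) / 2 + (H * τ) ^ 2) := by ring
      _ ≤ 6 * S.area := by linarith
  by_cases hK : Even K
  · rw [fundamentalBrick_region_even hK] at hroot
    obtain ⟨h1, h2, h3, -⟩ := le_of_rect_subset p.width_pos.le p.height_pos.le hroot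
    have h4 : c.2 = H + H * Y := by
      have h6 := foldl_half_corner_of_even l (fundamentalBrick K) hK
      have h7 : (fundamentalBrick K).corner.2 = H := by simp [fundamentalBrick, hK, hH]
      have h8 : brickHeight (fundamentalBrick K).level = H := by
        simp [fundamentalBrick, brickHeight, hK, hH]
      rw [h7, h8] at h6
      rw [hcorner]
      exact h6
    simp only at h1 h2 h3
    refine rect_subset h1 (by simp only; linarith) (hHpos.le.trans h3) ?_
    rw [h4, ← hsq]
    simpa using hlong
  · rw [fundamentalBrick_region_odd hK] at hroot
    obtain ⟨h1, -, h3, h5⟩ := le_of_rect_subset p.width_pos.le p.height_pos.le hroot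
    have h4 : c.1 = H + H * Y := by
      have h6 := foldl_half_corner_of_odd l (fundamentalBrick K) hK
      have h7 : (fundamentalBrick K).corner.1 = H := by simp [fundamentalBrick, hK, hH]
      have h8 : brickWidth (fundamentalBrick K).level = H := by
        simp [fundamentalBrick, brickWidth, hK, hH]
      rw [h7, h8] at h6
      rw [hcorner]
      exact h6
    simp only at h1 h3 h5
    refine rect_subset (hHpos.le.trans h1) ?_ h3 (by simp only; linarith)
    rw [h4]
    simpa using hlong

/-! ### Costs -/

lemma boundingSquareArea_le {P : List PlacedPiece} {a : ℝ} (ha : 0 ≤ a) (c : ℝ × ℝ)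
    (h : ∀ q ∈ P, q.region ⊆ rect c a a) : boundingSquareArea P ≤ a ^ 2 := by
  refine csInf_le ⟨0, ?_⟩ ⟨a, ha, rfl, c, h⟩
  rintro _ ⟨b, -, rfl, -⟩
  positivity

/-- Every finite set of placed pieces has a bounding square. -/
lemma exists_bounding_square (P : List PlacedPiece) :
    ∃ a : ℝ, 0 ≤ a ∧ ∃ c : ℝ × ℝ, ∀ q ∈ P, q.region ⊆ rect c a a := by
  suffices h : ∃ b : ℝ, 0 ≤ b ∧ ∀ q ∈ P, q.region ⊆ rect (-b, -b) (2 * b) (2 * b) by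
    obtain ⟨b, hb, h⟩ := h
    exact ⟨2 * b, by positivity, _, h⟩
  induction P with
  | nil => exact ⟨0, le_rfl, by simp⟩
  | cons q P ih =>
    obtain ⟨b, hb, h⟩ := ih
    have hw := q.piece.width_pos
    have hh := q.piece.height_pos
    have h1 := abs_nonneg q.corner.1
    have h2 := abs_nonneg q.corner.2
    refine ⟨b + |q.corner.1| + |q.corner.2| + q.piece.width + q.piece.height, by positivity, ?_⟩
    intro r hr
    rcases List.mem_cons.1 hr with rfl | hr
    · have := le_abs_self r.corner.1
      have := le_abs_self r.corner.2
      have := neg_abs_le r.corner.1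
      have := neg_abs_le r.corner.2
      refine rect_subset ?_ ?_ ?_ ?_ <;> simp only <;> linarith
    · refine (h r hr).trans (rect_subset ?_ ?_ ?_ ?_) <;> simp only <;> linarith

/-- The existence of a bounding square matters: the real infimum of the empty set is `0`. -/
lemma le_boundingSquareArea {P : List PlacedPiece} {A : ℝ}
    (h : ∀ a : ℝ, 0 ≤ a → ∀ c : ℝ × ℝ, (∀ q ∈ P, q.region ⊆ rect c a a) → A ≤ a ^ 2) :
    A ≤ boundingSquareArea P := by
  obtain ⟨a, ha, c, hc⟩ := exists_bounding_square P
  refine le_csInf ⟨_, a, ha, rfl, c, hc⟩ ?_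
  rintro _ ⟨a, ha, rfl, c, hc⟩
  exact h a ha c hc

lemma boundingSquareArea_nonneg (P : List PlacedPiece) : 0 ≤ boundingSquareArea P :=
  le_boundingSquareArea fun _ _ _ _ => sq_nonneg _

open MeasureTheory in
lemma volume_rect (c : ℝ × ℝ) (w h : ℝ) :
    volume (rect c w h) = ENNReal.ofReal w * ENNReal.ofReal h := by
  rw [rect, Measure.volume_eq_prod, Measure.prod_prod, Real.volume_Icc, Real.volume_Icc]
  simp

open MeasureTheory in
lemma volume_interior_rect (c : ℝ × ℝ) (w h : ℝ) :
    volume (interior (rect c w h)) = ENNReal.ofReal w * ENNReal.ofReal h := by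
  rw [rect, interior_prod_eq, interior_Icc, interior_Icc, Measure.volume_eq_prod,
    Measure.prod_prod, Real.volume_Ioo, Real.volume_Ioo]
  simp

open MeasureTheory in
/-- Interior-disjoint pieces inside a region have total area at most its area. -/
lemma sum_area_le_volume {P : List PlacedPiece}
    (hP : P.Pairwise fun q r => InteriorDisjoint q.region r.region) {R : Set (ℝ × ℝ)}
    (hR : ∀ q ∈ P, q.region ⊆ R) :
    (P.map fun q => ENNReal.ofReal q.piece.width * ENNReal.ofReal q.piece.height).sum ≤
      volume R := by
  -- Passing to interiors makes the pieces genuinely disjoint, since closed regions may share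
  -- boundary, and loses no area.
  suffices h : (P.map fun q => ENNReal.ofReal q.piece.width * ENNReal.ofReal q.piece.height).sum =
      volume (⋃ q ∈ P, interior q.region) by
    rw [h]
    exact measure_mono (iUnion₂_subset fun q hq => interior_subset.trans (hR q hq))
  clear hR
  induction P with
  | nil => simp
  | cons q P ih =>
    rw [List.pairwise_cons] at hP
    have hU : (⋃ r ∈ q :: P, interior r.region) =
        interior q.region ∪ ⋃ r ∈ P, interior r.region := by
      ext x; simp
    rw [hU, List.map_cons, List.sum_cons, ih hP.2, measure_union' _ isOpen_interior.measurableSet,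
      PlacedPiece.region, volume_interior_rect]
    rw [Set.disjoint_iUnion₂_right]
    exact fun r hr => hP.1 r hr

lemma squaresArea_cons (p : Piece) (L : List Piece) :
    squaresArea (p :: L) = p.width ^ 2 + squaresArea L := by
  simp [squaresArea]

lemma squaresArea_nonneg (L : List Piece) : 0 ≤ squaresArea L := by
  induction L with
  | nil => simp [squaresArea]
  | cons p L ih => rw [squaresArea_cons]; positivity

lemma squaresArea_le_boundingSquareArea {P : List PlacedPiece} {L : List Piece}
    (hL : ∀ p ∈ L, p.width = p.height) (hP : IsPackingOf P L) :
    squaresArea L ≤ boundingSquareArea P := by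
  refine le_boundingSquareArea fun a ha c hc => ?_
  have h := sum_area_le_volume hP.2 hc
  rw [volume_rect, ← ENNReal.ofReal_mul ha] at h
  have h2 : (P.map fun q => ENNReal.ofReal q.piece.width * ENNReal.ofReal q.piece.height).sum =
      ENNReal.ofReal (squaresArea L) := by
    obtain ⟨rfl, -⟩ := hP
    clear h hc
    induction P with
    | nil => simp [squaresArea]
    | cons q P ih =>
      rw [List.map_cons, List.sum_cons, ih fun p hp => hL p (by simp [hp]), List.map_cons,
        squaresArea_cons, ENNReal.ofReal_add (sq_nonneg _) (squaresArea_nonneg _),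
        ← hL q.piece (by simp), ← ENNReal.ofReal_mul q.piece.width_pos.le, sq]
  rw [h2, ENNReal.ofReal_le_ofReal_iff (by positivity)] at h
  rw [sq]; exact h

lemma squaresArea_le_optCost (L : SquareStream) : squaresArea L.1 ≤ optCost L := by
  -- The packing of the algorithm itself shows that the infimum is over a non-empty set.
  refine le_csInf ⟨_, _, isPackingOf_brickTranslation L.2.2, rfl⟩ ?_
  rintro _ ⟨P, hP, rfl⟩
  exact squaresArea_le_boundingSquareArea L.2.2 hP

lemma optCost_le {L : SquareStream} {P : List PlacedPiece} (hP : IsPackingOf P L.1) :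
    optCost L ≤ boundingSquareArea P := by
  refine csInf_le ⟨0, ?_⟩ ⟨P, hP, rfl⟩
  rintro _ ⟨Q, -, rfl⟩
  exact boundingSquareArea_nonneg Q

lemma squaresArea_pos (L : SquareStream) : 0 < squaresArea L.1 := by
  obtain ⟨L, hL, -⟩ := L
  cases L with
  | nil => exact absurd rfl hL
  | cons p L =>
    have := p.width_pos
    have h := squaresArea_nonneg L
    rw [squaresArea_cons]
    positivity

lemma optCost_pos (L : SquareStream) : 0 < optCost L :=
  (squaresArea_pos L).trans_le (squaresArea_le_optCost L)

theorem algCost_le (L : SquareStream) : algCost L ≤ 6 * optCost L := by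
  have hS := squareState_foldl L.2.2
  have h : algCost L ≤ (Real.sqrt (6 * squaresArea L.1)) ^ 2 := by
    refine boundingSquareArea_le (Real.sqrt_nonneg _) (0, 0) fun q hq => ?_
    obtain ⟨r, hr, rfl⟩ := List.mem_map.1 hq
    rw [← area_foldl]
    exact hS.region_subset_rect hr
  rw [Real.sq_sqrt (by linarith [squaresArea_pos L])] at h
  linarith [squaresArea_le_optCost L]

theorem hasAbsoluteCompetitiveRatio_six :
    HasAbsoluteCompetitiveRatio algCost optCost fun _ => 6 := by
  refine iSup_le fun L => ENNReal.div_le_of_le_mul ?_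
  rw [one_mul]
  exact ENNReal.ofReal_le_ofReal (by linarith [algCost_le L])

/-! ### Streams of equal squares -/

/-- The square of side length `s`. -/
def squarePiece (s : ℝ) (hs : 0 < s) : Piece := ⟨s, s, hs, hs⟩

/-- Equal squares are packed in grid position. -/
lemma exists_grid_packing {s : ℝ} (hs : 0 < s) {n q : ℕ} (hn : n ≤ q * q) :
    ∃ P, IsPackingOf P (List.replicate n (squarePiece s hs)) ∧
      boundingSquareArea P ≤ (q * s) ^ 2 := by
  refine ⟨(List.range n).map fun i =>
    ⟨squarePiece s hs, ((i % q : ℕ) * s, (i / q : ℕ) * s)⟩, ⟨?_, ?_⟩, ?_⟩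
  · rw [List.map_map]
    simp [List.eq_replicate_iff]
  · rw [List.pairwise_map]
    refine List.pairwise_lt_range.imp_of_mem fun {i j} _ hj hij => ?_
    simp only [PlacedPiece.region, squarePiece]
    rcases (Nat.div_le_div_right (c := q) hij.le).lt_or_eq with h | h
    · refine (interiorDisjoint_rect_of_above ?_).symm
      have : ((i / q : ℕ) : ℝ) + 1 ≤ (j / q : ℕ) := by exact_mod_cast h
      nlinarith
    · refine (interiorDisjoint_rect_of_right ?_).symm
      have hm : i % q < j % q := by
        have h1 := Nat.div_add_mod i q
        have h2 := Nat.div_add_mod j q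
        rw [h] at h1
        omega
      have : ((i % q : ℕ) : ℝ) + 1 ≤ (j % q : ℕ) := by exact_mod_cast hm
      nlinarith
  · refine boundingSquareArea_le (by positivity) (0, 0) fun r hr => ?_
    obtain ⟨i, hi, rfl⟩ := List.mem_map.1 hr
    have hi' : i < q * q := (List.mem_range.1 hi).trans_le hn
    have hq : 0 < q := Nat.pos_of_mul_pos_right (Nat.zero_lt_of_lt hi')
    have h1 : ((i % q : ℕ) : ℝ) + 1 ≤ q := by exact_mod_cast Nat.mod_lt i hq
    have h2 : ((i / q : ℕ) : ℝ) + 1 ≤ q := by exact_mod_cast Nat.div_lt_of_lt_mul hi'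
    refine rect_subset ?_ ?_ ?_ ?_ <;> simp only [squarePiece]
    · positivity
    · nlinarith
    · positivity
    · nlinarith

lemma nested_self_iff {k : ℤ} {x a : ℕ} : Nested k x k a ↔ x = a := by
  constructor
  · rintro ⟨d, ⟨hk, h⟩ | ⟨hk, h⟩⟩ <;>
    · obtain rfl : d = 0 := by omega
      simp only [pow_zero, Nat.div_one] at h
      omega
  · rintro rfl
    exact ⟨0, by simp⟩

/-- Equal squares are packed in consecutive bricks of the suitable level. -/
lemma intervals_foldl_replicate {p : Piece} (hp : p.width = p.height) (n : ℕ) :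
    State.intervals ((List.replicate n p).foldl brickStep []) =
      (List.range n).map fun i => (suitableLevel p, i + 1) := by
  induction n with
  | zero => rfl
  | succ n ih =>
    have hS : SquareState ((List.replicate n p).foldl brickStep []) :=
      squareState_foldl fun q hq => by rw [List.eq_of_mem_replicate hq]; exact hp
    rw [List.replicate_succ', List.foldl_append, List.foldl_cons, List.foldl_nil,
      hS.brickStep_eq hp]
    set S := (List.replicate n p).foldl brickStep []
    set D := minFree (suitableLevel p) S.bricks
    have hmin : IsMinFree (suitableLevel p) S.bricks D := isMinFree_minFree _ _
    have hle : D.index ≤ n + 1 := by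
      refine hmin.index_le (by omega) ?_
      rw [ih]
      intro e he
      obtain ⟨i, hi, rfl⟩ := List.mem_map.1 he
      have := List.mem_range.1 hi
      rw [nested_self_iff]
      omega
    have hge : ¬ D.index ≤ n := by
      intro h
      have hpos := D.index_pos
      refine freeInterval_intervals.2 hmin.1.2 (suitableLevel p, D.index) ?_ ?_
      · rw [ih]
        exact List.mem_map.2 ⟨D.index - 1, List.mem_range.2 (by omega), by
          rw [Nat.sub_add_cancel hpos]⟩
      · rw [hmin.1.1]
        exact nested_self_iff.2 rfl
    rw [List.range_succ, List.map_append, ← ih, State.intervals, List.map_append]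
    congr 1
    simp only [List.map_cons, List.map_nil, List.cons.injEq, and_true, Prod.mk.injEq]
    exact ⟨hmin.1.1, by omega⟩

/-- A derived brick of the suitable level is used once sufficiently many equal squares have
arrived. -/
lemma mem_brickTranslation_replicate {p : Piece} (hp : p.width = p.height) {n : ℕ}
    {D : DerivedBrick} (hD : D.level = suitableLevel p) (hn : D.index ≤ n) :
    (⟨p, D.toBrick.corner⟩ : PlacedPiece) ∈ brickTranslation (List.replicate n p) := by
  have hS : SquareState ((List.replicate n p).foldl brickStep []) :=
    squareState_foldl fun q hq => by rw [List.eq_of_mem_replicate hq]; exact hp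
  have hmem : (D.level, D.index) ∈ State.intervals ((List.replicate n p).foldl brickStep []) := by
    have hpos := D.index_pos
    rw [intervals_foldl_replicate hp, hD]
    exact List.mem_map.2 ⟨D.index - 1, List.mem_range.2 (by omega), by
      rw [Nat.sub_add_cancel hpos]⟩
  obtain ⟨q, hq, h⟩ := List.mem_map.1 hmem
  rw [Prod.mk.injEq] at h
  have hqD : q.2 = D := DerivedBrick.ext_of_level_index h.1 h.2
  have hqp : q.1.piece = p := by
    have h1 := map_piece_foldl (List.replicate n p)
    have h2 := List.mem_map_of_mem (f := fun q : PlacedPiece × DerivedBrick => q.1.piece) hq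
    rw [h1] at h2
    exact List.eq_of_mem_replicate h2
  refine List.mem_map.2 ⟨q, hq, ?_⟩
  rw [← hqD, ← hqp, ← hS.corner q hq]

lemma suitableLevel_eq_zero {s : ℝ} (hs : 0 < s) (h1 : 1 / 2 < s) (h2 : s ≤ (Real.sqrt 2)⁻¹) :
    suitableLevel (squarePiece s hs) = 0 := by
  obtain ⟨h3, h4⟩ := (suitable_suitableLevel (squarePiece s hs)).square rfl
  set k := suitableLevel (squarePiece s hs)
  simp only [squarePiece] at h3 h4
  rw [← sqrt_two_zpow_half] at h3
  have e1 : (Real.sqrt 2) ^ (-2 : ℤ) = 1 / 2 := by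
    simp
  have e2 : (Real.sqrt 2) ^ (-1 : ℤ) = (Real.sqrt 2)⁻¹ := zpow_neg_one _
  have h5 := (zpow_lt_zpow_iff_right₀ one_lt_sqrt_two).1 (h3.trans_le (h2.trans e2.ge))
  have h6 := (zpow_lt_zpow_iff_right₀ one_lt_sqrt_two).1 (e1.trans_lt (h1.trans_le h4))
  omega

/-! ### The lower bound -/

/-- The path `1, 2, 1, 2, …, 1, 2` of length `2 m`, leading to the brick in the upper left
corner. -/
def cornerPath : ℕ → List Bool
  | 0 => []
  | m + 1 => false :: true :: cornerPath m

lemma length_cornerPath (m : ℕ) : (cornerPath m).length = 2 * m := by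
  induction m with
  | zero => rfl
  | succ m ih => simp [cornerPath, ih]; ring

lemma evenDigits_cornerPath (m : ℕ) : evenDigits (cornerPath m) = 1 - (2 ^ m)⁻¹ := by
  induction m with
  | zero => simp [cornerPath, evenDigits]
  | succ m ih =>
    simp only [cornerPath, evenDigits, ih, Bool.toNat_true, pow_succ, mul_inv]
    push_cast
    ring

lemma binValue_cornerPath (m : ℕ) : 3 * binValue (cornerPath m) + 1 = 4 ^ m := by
  induction m with
  | zero => simp [cornerPath, binValue]
  | succ m ih =>
    simp only [cornerPath, binValue, Bool.toNat_true, Bool.toNat_false, length_cornerPath, pow_mul]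
    norm_num [pow_succ]
    omega

/-- The `0`-brick in the upper left corner of the fundamental brick of index `-2 m`. -/
def cornerBrick (m : ℕ) : DerivedBrick := ⟨-(2 * m : ℕ), cornerPath m⟩

lemma level_cornerBrick (m : ℕ) : (cornerBrick m).level = 0 := by
  rw [DerivedBrick.level_eq, cornerBrick, length_cornerPath, neg_add_cancel]

/-- The digits `1 01 01 ⋯ 01` are the geometric sum `4^m + 4^(m-1) + ⋯ + 1`. -/
lemma index_cornerBrick (m : ℕ) : 3 * (cornerBrick m).index + 1 = 4 * 4 ^ m := by
  have := binValue_cornerPath m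
  rw [DerivedBrick.index, cornerBrick, length_cornerPath, pow_mul]
  norm_num
  omega

lemma corner_cornerBrick (m : ℕ) :
    (cornerBrick m).toBrick.corner.2 = (2 * 2 ^ m - 1) / Real.sqrt 2 := by
  have he : Even (-(2 * m : ℕ) : ℤ) := ⟨-m, by push_cast; ring⟩
  have h := foldl_half_corner_of_even (cornerPath m) (fundamentalBrick (-(2 * m : ℕ))) he
  have hz : (Real.sqrt 2) ^ (-(-(2 * m : ℕ) : ℤ) - 1) = 2 ^ m / Real.sqrt 2 := by
    rw [neg_neg, zpow_sub_one₀ (by positivity), zpow_natCast, pow_mul,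
      Real.sq_sqrt (by norm_num), div_eq_mul_inv]
  have h1 : (fundamentalBrick (-(2 * m : ℕ))).corner.2 = 2 ^ m / Real.sqrt 2 := by
    rw [← hz, fundamentalBrick, if_pos he]
  have h2 : brickHeight (fundamentalBrick (-(2 * m : ℕ))).level = 2 ^ m / Real.sqrt 2 := by
    rw [← hz, fundamentalBrick, brickHeight, if_pos he]
  rw [h1, h2, evenDigits_cornerPath] at h
  rw [DerivedBrick.toBrick, cornerBrick, h]
  field_simp
  ring

/-- The side length of the squares in the `m`-th tight stream. -/
def tightSide (m : ℕ) : ℝ := 1 / 2 + (2 ^ m)⁻¹ / 8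

lemma tightSide_pos (m : ℕ) : 0 < tightSide m := by unfold tightSide; positivity

lemma half_lt_tightSide (m : ℕ) : 1 / 2 < tightSide m := by
  have : (0 : ℝ) < (2 ^ m)⁻¹ := by positivity
  unfold tightSide
  linarith

/-- The side must exceed `1/2` and tend to it while staying suitable for level `0`; the factor `1/8`
keeps it at most `5/8 < 1/√2`. -/
lemma tightSide_le (m : ℕ) : tightSide m ≤ (Real.sqrt 2)⁻¹ := by
  have h1 : ((2 : ℝ) ^ m)⁻¹ ≤ 1 := inv_le_one_of_one_le₀ (one_le_pow₀ (by norm_num))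
  have h2 : Real.sqrt 2 ≤ 8 / 5 := by
    rw [Real.sqrt_le_left (by norm_num)]; norm_num
  have h3 : (8 / 5 : ℝ)⁻¹ ≤ (Real.sqrt 2)⁻¹ := inv_anti₀ (by positivity) h2
  unfold tightSide
  norm_num at h3
  linarith

/-- Equal squares that fill the bricks up to the upper left corner of a fundamental brick. -/
def tightStream (m : ℕ) : SquareStream :=
  ⟨List.replicate (cornerBrick m).index (squarePiece (tightSide m) (tightSide_pos m)), by
    have := (cornerBrick m).index_pos
    simp only [ne_eq, List.replicate_eq_nil_iff]
    omega, fun p hp => by rw [List.eq_of_mem_replicate hp]; rfl⟩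

/-- Already the vertical distance between the squares in `B_0`, which is `cornerBrick 0`, and in
`cornerBrick m` is `√2 (2^m - 1)`. -/
lemma le_algCost_tightStream (m : ℕ) : 2 * (2 ^ m - 1) ^ 2 ≤ algCost (tightStream m) := by
  refine le_boundingSquareArea fun a ha c hc => ?_
  have hlev := suitableLevel_eq_zero (tightSide_pos m) (half_lt_tightSide m) (tightSide_le m)
  have hlast := mem_brickTranslation_replicate (n := (cornerBrick m).index)
    (p := squarePiece (tightSide m) (tightSide_pos m)) rfl
    ((level_cornerBrick m).trans hlev.symm) le_rfl
  have hfirst := mem_brickTranslation_replicate (n := (cornerBrick m).index)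
    (p := squarePiece (tightSide m) (tightSide_pos m)) rfl (D := cornerBrick 0)
    ((level_cornerBrick 0).trans hlev.symm) (by
      have := (cornerBrick m).index_pos
      have := index_cornerBrick 0
      omega)
  have hs := tightSide_pos m
  obtain ⟨-, -, -, h1⟩ := le_of_rect_subset hs.le hs.le (hc _ hlast)
  obtain ⟨-, -, h2, -⟩ := le_of_rect_subset hs.le hs.le (hc _ hfirst)
  simp only [corner_cornerBrick] at h1 h2
  have h3 : Real.sqrt 2 * (2 ^ m - 1) ≤ a := by
    have h4 : (2 * 2 ^ m - 1) / Real.sqrt 2 - (2 * 2 ^ 0 - 1) / Real.sqrt 2 =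
        Real.sqrt 2 * (2 ^ m - 1) := by
      rw [← sub_div, div_eq_iff (by positivity)]
      linear_combination (-(2 ^ m - 1) : ℝ) * Real.sq_sqrt (show (0 : ℝ) ≤ 2 by norm_num)
    linarith
  have h5 : (0 : ℝ) ≤ 2 ^ m - 1 := sub_nonneg.2 (one_le_pow₀ (by norm_num))
  calc (2 : ℝ) * (2 ^ m - 1) ^ 2 = (Real.sqrt 2 * (2 ^ m - 1)) ^ 2 := by
        rw [mul_pow, Real.sq_sqrt (by norm_num)]
    _ ≤ a ^ 2 := pow_le_pow_left₀ (by positivity) h3 2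

lemma optCost_tightStream_le (m : ℕ) :
    optCost (tightStream m) ≤ ((2 / Real.sqrt 3 * 2 ^ m + 1) * tightSide m) ^ 2 := by
  set n := (cornerBrick m).index with hn
  -- Rounding `√n` up costs at most one row and column, which is the `+ 1` in the bound and vanishes
  -- in the limit ratio.
  obtain ⟨P, hP, hPle⟩ := exists_grid_packing (tightSide_pos m) (n := n) (q := n.sqrt + 1)
    (Nat.lt_succ_sqrt n).le
  refine (optCost_le hP).trans (hPle.trans ?_)
  have hs := tightSide_pos m
  refine pow_le_pow_left₀ (by positivity) (mul_le_mul_of_nonneg_right ?_ hs.le) 2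
  push_cast
  refine add_le_add_left ?_ _
  have h1 : (n.sqrt : ℝ) ^ 2 ≤ n := by exact_mod_cast Nat.sqrt_le' n
  have h2 : (3 * n + 1 : ℝ) = 4 * 4 ^ m := by exact_mod_cast index_cornerBrick m
  refine le_of_sq_le_sq ?_ (by positivity)
  rw [mul_pow, div_pow, Real.sq_sqrt (by norm_num), ← pow_mul, mul_comm m 2, pow_mul]
  norm_num
  linarith

lemma le_optCost_tightStream (m : ℕ) : (4 : ℝ) ^ m / 4 ≤ optCost (tightStream m) := by
  refine le_trans ?_ (squaresArea_le_optCost _)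
  have h2 : (3 * (cornerBrick m).index + 1 : ℝ) = 4 * 4 ^ m := by
    exact_mod_cast index_cornerBrick m
  have h3 := half_lt_tightSide m
  have h4 : (1 : ℝ) ≤ 4 ^ m := one_le_pow₀ (by norm_num)
  have h5 : (1 / 4 : ℝ) ≤ tightSide m ^ 2 := by nlinarith
  simp only [squaresArea, tightStream, List.map_replicate, List.sum_replicate, nsmul_eq_mul,
    squarePiece]
  nlinarith

lemma tendsto_inv_two_pow : Tendsto (fun m : ℕ => ((2 : ℝ) ^ m)⁻¹) atTop (𝓝 0) := by
  simp_rw [← inv_pow]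
  exact tendsto_pow_atTop_nhds_zero_of_lt_one (by norm_num) (by norm_num)

lemma tendsto_ratio_tightStream :
    Tendsto (fun m => algCost (tightStream m) / optCost (tightStream m)) atTop (𝓝 6) := by
  have hlim : Tendsto (fun m : ℕ => 2 * (1 - ((2 : ℝ) ^ m)⁻¹) ^ 2 /
      ((2 / Real.sqrt 3 + ((2 : ℝ) ^ m)⁻¹) * (1 / 2 + ((2 : ℝ) ^ m)⁻¹ / 8)) ^ 2) atTop
      (𝓝 6) := by
    -- After dividing by `4^m`, the lower bound for the ratio is a continuous function of `x = 2⁻ᵐ`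
    -- at `0`, with value `2 / (1/√3)² = 6`.
    have hc : ContinuousAt (fun x : ℝ => 2 * (1 - x) ^ 2 /
        ((2 / Real.sqrt 3 + x) * (1 / 2 + x / 8)) ^ 2) 0 := by
      refine ContinuousAt.div (by fun_prop) (by fun_prop) ?_
      have : (0 : ℝ) < Real.sqrt 3 := by positivity
      simp only [add_zero, zero_div]
      positivity
    have h6 : (2 : ℝ) * (1 - 0) ^ 2 / ((2 / Real.sqrt 3 + 0) * (1 / 2 + 0 / 8)) ^ 2 = 6 := by
      rw [add_zero, mul_pow, div_pow, Real.sq_sqrt (by norm_num)]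
      norm_num
    have := hc.tendsto.comp tendsto_inv_two_pow
    rw [h6] at this
    exact this
  refine tendsto_of_tendsto_of_tendsto_of_le_of_le hlim tendsto_const_nhds (fun m => ?_)
    (fun m => ?_)
  · have hO := optCost_pos (tightStream m)
    have h1 := le_algCost_tightStream m
    have h2 := optCost_tightStream_le m
    have hx : (0 : ℝ) < 2 ^ m := by positivity
    have h3 : (0 : ℝ) < Real.sqrt 3 := by positivity
    have hs := tightSide_pos m
    calc 2 * (1 - ((2 : ℝ) ^ m)⁻¹) ^ 2 /
        ((2 / Real.sqrt 3 + ((2 : ℝ) ^ m)⁻¹) * (1 / 2 + ((2 : ℝ) ^ m)⁻¹ / 8)) ^ 2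
        = 2 * (2 ^ m - 1) ^ 2 / ((2 / Real.sqrt 3 * 2 ^ m + 1) * tightSide m) ^ 2 := by
          have e1 : (2 : ℝ) ^ m - 1 = 2 ^ m * (1 - ((2 : ℝ) ^ m)⁻¹) := by field_simp
          have e2 : 2 / Real.sqrt 3 * 2 ^ m + 1 =
              2 ^ m * (2 / Real.sqrt 3 + ((2 : ℝ) ^ m)⁻¹) := by field_simp
          rw [e1, e2, mul_assoc (2 ^ m : ℝ), mul_pow (2 ^ m : ℝ), mul_pow (2 ^ m : ℝ), mul_left_comm,
            mul_div_mul_left _ _ (by positivity), tightSide]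
      _ ≤ algCost (tightStream m) / optCost (tightStream m) :=
          div_le_div₀ (le_trans (by positivity) h1) h1 hO h2
  · exact (div_le_iff₀ (optCost_pos _)).2 (algCost_le _)

lemma tendsto_optCost_tightStream :
    Tendsto (fun m => optCost (tightStream m)) atTop atTop := by
  refine tendsto_atTop_mono le_optCost_tightStream ?_
  exact (tendsto_pow_atTop_atTop_of_one_lt (by norm_num)).atTop_div_const (by norm_num)

end OnlinePacking
end

theorem mainTheorem3 :
    (∀ L : OnlinePacking.SquareStream,
      OnlinePacking.IsPackingOf (OnlinePacking.brickTranslation L.1) L.1) ∧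
    OnlinePacking.HasAbsoluteCompetitiveRatio
      OnlinePacking.algCost OnlinePacking.optCost (fun _ => 6) ∧
    ∃ L : ℕ → OnlinePacking.SquareStream,
      Tendsto (fun n => OnlinePacking.algCost (L n) / OnlinePacking.optCost (L n)) atTop (𝓝 6) ∧
      Tendsto (fun n => OnlinePacking.optCost (L n)) atTop atTop :=
  ⟨fun L => OnlinePacking.isPackingOf_brickTranslation L.2.2,
    OnlinePacking.hasAbsoluteCompetitiveRatio_six, OnlinePacking.tightStream,
    OnlinePacking.tendsto_ratio_tightStream, OnlinePacking.tendsto_optCost_tightStream⟩
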